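/- **Setting.** Let $K$ be a compact Polish Abelian group with Haar measure $\lambda_K$, let $v$ be a continuous automorphism of $K$, and assume that the set $\mathcal K$ of $v$-periodic points of $K$ is countable and dense in $K$. For $a\in\mathcal K$ let $m_a$ be the least positive period of $a$ under $v$. Fix a partition $$\mathbb N=\{1,2,\dots\}=\bigsqcup_{a\in\mathcal K}\mathcal N_a\ \sqcup\ \bigsqcup_{k\ge 1}\bigsqcup_{b\in\mathcal K}\mathcal M_{b,k}$$ into infinite subsets. **The sequences.** Put $h_0=1$, let $h_1\ge 1$, let $C_1\subset\{0,\dots,h_1-1\}$ be any set containing $0$, and let $\alpha_1:C_1\to K$ be any map. For $n\ge 1$ define inductively integers $h_{n+1},z_{n+1}$, finite sets $C_{n+1}\subset\mathbb Z$ and maps $\alpha_{n+1}:C_{n+1}\to K$ as follows. * If $n+1\in\mathcal N_a$: $z_{n+1}=2m_anh_n$, $r_n=n^3m_a$, $C_{n+1}=2h_n\cdot\{0,\dots,r_n-1\}$, $h_{n+1}=2r_nh_n$, and $\alpha_{n+1}$ is any map such that (A1) $\alpha_{n+1}(c+z_{n+1})=v(\alpha_{n+1}(c))$ for all $c\in C_{n+1}\cap(C_{n+1}-z_{n+1})$,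 and (A2) for each $0\le i<m_a$ there is $C_{n+1,i}\subset C_{n+1}$ with $C_{n+1,i}-2h_n\subset C_{n+1}$, $\alpha_{n+1}(c)=\alpha_{n+1}(c-2h_n)+v^i(a)$ for all $c\in C_{n+1,i}$, and $\bigl|\frac{\#C_{n+1,i}}{\#C_{n+1}}-\frac1{m_a}\bigr|<\frac2{nm_a}$. * If $n+1\in\mathcal M_{b,k}$: $z_{n+1}=m_bn(2h_n(k+1)+k)$, $r_n=n^3(k+1)m_b$, $D_{n+1}=2h_n\cdot\{0,\dots,nm_b-1\}\sqcup\bigl((2h_n+1)\cdot\{1,\dots,nkm_b\}+2h_n(nm_b-1)\bigr)$, $C_{n+1}=D_{n+1}+z_{n+1}\cdot\{0,\dots,n^2-1\}$, $h_{n+1}=2r_nh_n+\frac{kr_n}{k+1}$, and $\alpha_{n+1}$ is any map such that (A3) $\alpha_{n+1}(c+z_{n+1})=v(\alpha_{n+1}(c))$ for all $c\in C_{n+1}\cap(C_{n+1}-z_{n+1})$; (A4) for each $0\le i<m_b$ there is $C_{n+1,i}\subset C_{n+1}$ with $C_{n+1,i}-2h_n\subset C_{n+1}$, $\alpha_{n+1}(c)=\alpha_{n+1}(c-2h_n)+v^i(b)$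 for all $c\in C_{n+1,i}$, and $\bigl|\frac{\#C_{n+1,i}}{\#C_{n+1}}-\frac1{(k+1)m_b}\bigr|<\frac2{nm_b}$; (A5) there is $C_{n+1,\vartriangle}\subset C_{n+1}$ with $C_{n+1,\vartriangle}-2h_n-1\subset C_{n+1}$, $\alpha_{n+1}(c)=\alpha_{n+1}(c-2h_n-1)$ for all $c\in C_{n+1,\vartriangle}$, and $\bigl|\frac{\#C_{n+1,\vartriangle}}{\#C_{n+1}}-\frac k{k+1}\bigr|<\frac2n$. **The transformation.** Let $F_n=\{0,\dots,h_n-1\}$ and $X_n=F_n\times C_{n+1}\times C_{n+2}\times\cdots$ with the product topology. Embed $X_n$ into $X_{n+1}$ by $(f,c_{n+1},c_{n+2},\dots)\mapsto(f+c_{n+1},c_{n+2},\dots)$ and let $X=\bigcup_{n\ge 0}X_n$ with the inductive limit topology and its Borel $\sigma$-algebra. Let $\mu$ be the measure on $X$ whose restriction to each $X_n$ is the product of $(\#C_1\cdots\#C_n)^{-1}$ times counting measure on $F_n$ and of the uniform probability measures on $C_{n+1},C_{n+2},\dots$; it is the $\sigma$-finite measure with $\mu(X_0)=1$ that is invariant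 under the tail equivalence relation $\mathcal R$ of $X$. Define $T:X\to X$ by $T(f_n,c_{n+1},\dots)=(1+f_n,c_{n+1},\dots)$ whenever $f_n<h_n-1$, $n>0$. **The cocycle.** For $x\in X$ let $n\ge 0$ be least with $x\in X_n$, write $x=(f_n,c_{n+1},c_{n+2},\dots)\in X_n$, and put $\pi(x)=(0,\dots,0,c_{n+1},c_{n+2},\dots)\in X_0$. For $(x,y)\in\mathcal R$ with $\pi(x)=(0,c_1,c_2,\dots)$ and $\pi(y)=(0,c_1',c_2',\dots)$ put $\alpha(x,y)=\sum_{n>0}(\alpha_n(c_n)-\alpha_n(c_n'))$. Let $T_\alpha(x,g)=(Tx,\alpha(Tx,x)+g)$ on $(X\times K,\mu\times\lambda_K)$. **Proposition.** For every integer $p>0$, the transformation $T^{\times p}\times T_\alpha$ of $(X^p\times X\times K,\ \mu^{p}\times\mu\times\lambda_K)$ is measure preserving and ergodic. In particular, for every $p>0$ the Cartesian power $T^{\times p}$ of $(X^p,\mu^p)$ is ergodic. -/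

import Mathlib

open MeasureTheory Filter Topology

noncomputable section

/-! ### The (C,F)-construction -/

/-- The input `(C_{n+1}, F_n)_{n ≥ 0}` of the (C,F)-construction of an infinite measure preserving
map, with `F_n = {0, …, h_n - 1} ⊂ ℤ`. The set `C_0` plays no role. -/
structure CFData where
  h : ℕ → ℕ
  C : ℕ → Finset ℤ
  h_zero : h 0 = 1
  zero_mem : ∀ n, 0 ∈ C n
  /-- `#C_n > 1`, required for all large `n` only. -/
  one_lt_card : ∀ᶠ n in atTop, 1 < (C n).card
  /-- `F_n + C_{n+1} ⊂ F_{n+1}`. -/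
  add_mem : ∀ n, ∀ f ∈ Finset.Ico (0 : ℤ) (h n), ∀ c ∈ C (n + 1),
    f + c ∈ Finset.Ico (0 : ℤ) (h (n + 1))
  /-- `(F_n + c) ∩ (F_n + c') = ∅` for `c ≠ c'` in `C_{n+1}`. -/
  disjoint : ∀ n, ∀ f ∈ Finset.Ico (0 : ℤ) (h n), ∀ f' ∈ Finset.Ico (0 : ℤ) (h n),
    ∀ c ∈ C (n + 1), ∀ c' ∈ C (n + 1), c ≠ c' → f + c ≠ f' + c'
  /-- `h_n / (#C_1 ⋯ #C_n) → ∞`. -/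
  tendsto_ratio : Tendsto
    (fun n => (h n : ℝ) / ∏ j ∈ Finset.Icc 1 n, ((C j).card : ℝ)) atTop atTop

namespace CFData

variable (D : CFData)

/-- `F_n = {0, …, h_n - 1}`. -/
def F (n : ℕ) : Finset ℤ := Finset.Ico (0 : ℤ) (D.h n)

instance (m : ℕ) : Nonempty (D.C m) := ⟨⟨0, D.zero_mem m⟩⟩

/-- `X_n = F_n × C_{n+1} × C_{n+2} × ⋯` (with the product topology and product σ-algebra). -/
abbrev Level (n : ℕ) : Type := D.F n × (∀ m : Set.Ioi n, D.C m)

/-- The embedding `(f, c_{n+1}, c_{n+2}, …) ↦ (f + c_{n+1}, c_{n+2}, …)` of `X_n` into `X_{n+1}`. -/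
def incl (n : ℕ) (x : D.Level n) : D.Level (n + 1) :=
  (⟨(x.1 : ℤ) + (x.2 ⟨n + 1, Nat.lt_succ_self n⟩ : ℤ),
      D.add_mem n _ x.1.2 _ (x.2 ⟨n + 1, Nat.lt_succ_self n⟩).2⟩,
    fun m => x.2 ⟨m, lt_trans (Nat.lt_succ_self n) m.2⟩)

/-- The identification of every point of `X_n` with its image in `X_{n+1}`. -/
def Glue (x y : Σ n, D.Level n) : Prop := y = ⟨x.1 + 1, D.incl x.1 x.2⟩

/-- The space `X = ⋃ X_n`: the inductive limit of the embeddings `X_n → X_{n+1}`. -/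
def X : Type := Quot D.Glue

/-- The inductive limit topology. -/
instance : TopologicalSpace D.X := inferInstanceAs (TopologicalSpace (Quot D.Glue))

instance : MeasurableSpace D.X := borel D.X

instance : BorelSpace D.X := ⟨rfl⟩

/-- The canonical map `X_n → X`; its range is `X_n` regarded as a subset of `X`. -/
def ι (n : ℕ) (x : D.Level n) : D.X := Quot.mk D.Glue ⟨n, x⟩

/-- The measure on `X_n` which is the product of `(#C_1 ⋯ #C_n)⁻¹ ·` counting measure on `F_n`
and of the uniform probabilities on `C_{n+1}, C_{n+2}, …`. -/
def levelMeasure (n : ℕ) : Measure (D.Level n) :=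
  (∏ j ∈ Finset.Icc 1 n, ((D.C j).card : ENNReal))⁻¹ •
    (Measure.count : Measure (D.F n)).prod
      (Measure.infinitePi fun m : Set.Ioi n => (PMF.uniformOfFintype (D.C m)).toMeasure)

/-- The invariant measure `μ` of the (C,F)-construction, normalized by `μ(X_0) = 1`: the measure on
`X` whose restriction to each `X_n` is `levelMeasure n`. It is glued from the pieces
`X_n \ (X_0 ∪ ⋯ ∪ X_{n-1})`, which partition `X`. -/
def μ : Measure D.X :=
  Measure.sum fun n =>
    ((D.levelMeasure n).map (D.ι n)).restrict (disjointed (fun k => Set.range (D.ι k)) n)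

open Classical in
/-- The (C,F)-transformation: `T (f_n, c_{n+1}, …) = (1 + f_n, c_{n+1}, …)` whenever `f_n < h_n - 1`.
At the points where this defines nothing for any `n`, `T` is given the value `T x = x`. -/
def T (x : D.X) : D.X :=
  if H : ∃ (n : ℕ) (y : D.Level n), D.ι n y = x ∧ (y.1 : ℤ) + 1 ∈ D.F n then
    D.ι H.choose (⟨_, H.choose_spec.choose_spec.2⟩, H.choose_spec.choose.2)
  else x

theorem exists_rep (x : D.X) : ∃ (n : ℕ) (y : D.Level n), D.ι n y = x :=
  Quot.inductionOn x fun s => ⟨s.1, s.2, rfl⟩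

open Classical in
/-- The least `n ≥ 0` with `x ∈ X_n`. -/
def lev (x : D.X) : ℕ := Nat.find (D.exists_rep x)

open Classical in
/-- The point `x`, written as an element `(f_n, c_{n+1}, …)` of `X_n` for `n = lev x`. -/
def rep (x : D.X) : D.Level (D.lev x) := (Nat.find_spec (D.exists_rep x)).choose

/-- The map `π : X → X_0`, `π x = (0, …, 0, c_{n+1}, c_{n+2}, …)` where `n` is least with `x ∈ X_n`
and `x = (f_n, c_{n+1}, c_{n+2}, …)` in `X_n`. -/
def toZero (x : D.X) : D.Level 0 :=
  (⟨0, by simp [F, D.h_zero]⟩,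
    fun m => if hm : D.lev x < m then (D.rep x).2 ⟨m, hm⟩ else ⟨0, D.zero_mem m⟩)

variable {K : Type*} [AddCommGroup K]

/-- The (C,F)-cocycle associated with maps `α_n : C_n → K` (`n ≥ 1`; the values of `α_n` off `C_n`
are not used): `α(x, y) = ∑_{n > 0} (α_n(c_n) - α_n(c_n'))`, where `π x = (0, c_1, c_2, …)` and
`π y = (0, c_1', c_2', …)`. If `x`, `y` are tail equivalent, all but finitely many terms vanish; on
other pairs the value is irrelevant. -/
def cocycle (α : ℕ → ℤ → K) (x y : D.X) : K :=
  ∑ᶠ m : Set.Ioi 0, (α m ((D.toZero x).2 m) - α m ((D.toZero y).2 m))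

/-- The skew product `T_α (x, k) = (T x, α(T x, x) + k)` on `X × K`. -/
def skew (α : ℕ → ℤ → K) (q : D.X × K) : D.X × K :=
  (D.T q.1, D.cocycle α (D.T q.1) q.1 + q.2)

end CFData

/-! ### The special (C,F)-sequences -/

section Special

variable {K : Type*} (v : K → K)

/-- The index set of the partition of `ℕ`: `inl a` labels the cell `N_a` and `inr (b, k)` labels the
cell `M_{b,k}`, for `v`-periodic points `a`, `b` and integers `k ≥ 1`. -/
abbrev CellLabel : Type _ := Function.periodicPts v ⊕ Function.periodicPts v × ℕ+

/-- The least positive period `m_a` of a `v`-periodic point `a`. -/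
abbrev per (a : Function.periodicPts v) : ℕ := Function.minimalPeriod v a

/-- `z_{n+1}`, in terms of `n`, `h_n` and the cell containing `n + 1`. -/
def nextZ (n h : ℕ) : CellLabel v → ℕ
  | .inl a => 2 * per v a * n * h
  | .inr (b, k) => per v b * n * (2 * h * (k + 1) + k)

/-- `r_n`, in terms of `n` and the cell containing `n + 1`. -/
def nextR (n : ℕ) : CellLabel v → ℕ
  | .inl a => n ^ 3 * per v a
  | .inr (b, k) => n ^ 3 * (k + 1) * per v b

/-- `D_{n+1}`, in terms of `n`, `h_n`, `m_b` and `k` when `n + 1 ∈ M_{b,k}`: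
`2h_n·{0, …, n m_b - 1} ⊔ ((2h_n+1)·{1, …, n k m_b} + 2h_n(n m_b - 1))`. -/
def blockD (n h m k : ℕ) : Finset ℤ :=
  (Finset.range (n * m)).image (fun j : ℕ => 2 * (h : ℤ) * j) ∪
    (Finset.Icc 1 (n * k * m)).image
      (fun j : ℕ => (2 * (h : ℤ) + 1) * j + 2 * h * ((n : ℤ) * m - 1))

/-- `C_{n+1}`, in terms of `n`, `h_n` and the cell containing `n + 1`. -/
def nextC (n h : ℕ) : CellLabel v → Finset ℤ
  | .inl a => (Finset.range (nextR v n (.inl a))).image fun j : ℕ => 2 * (h : ℤ) * j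
  | .inr (b, k) => (blockD n h (per v b) k ×ˢ Finset.range (n ^ 2)).image
      fun q : ℤ × ℕ => q.1 + (nextZ v n h (.inr (b, k)) : ℤ) * q.2

/-- `h_{n+1}`, in terms of `n`, `h_n` and the cell containing `n + 1`. The division by `k + 1` is
exact. -/
def nextH (n h : ℕ) : CellLabel v → ℕ
  | .inl a => 2 * nextR v n (.inl a) * h
  | .inr (b, k) => 2 * nextR v n (.inr (b, k)) * h + k * nextR v n (.inr (b, k)) / (k + 1)

theorem per_pos (a : Function.periodicPts v) : 0 < per v a :=
  Function.minimalPeriod_pos_of_mem_periodicPts a.2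

theorem blockD_bounds {n h m k : ℕ} (hn : 0 < n) (hm : 0 < m) {x : ℤ} (hx : x ∈ blockD n h m k) :
    0 ≤ x ∧ x + 2 * h ≤ ((m * n * (2 * h * (k + 1) + k) : ℕ) : ℤ) := by
  have hnm : (1 : ℤ) ≤ (n : ℤ) * m := by exact_mod_cast Nat.mul_pos hn hm
  have hh : (0 : ℤ) ≤ h := Int.natCast_nonneg h
  have hk : (0 : ℤ) ≤ k := Int.natCast_nonneg k
  simp only [blockD, Finset.mem_union, Finset.mem_image, Finset.mem_range, Finset.mem_Icc] at hx
  push_cast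
  rcases hx with ⟨j, hj, rfl⟩ | ⟨j, ⟨hj1, hj⟩, rfl⟩
  · have hj' : (j : ℤ) + 1 ≤ (n : ℤ) * m := by exact_mod_cast hj
    refine ⟨by positivity, ?_⟩
    have h1 : (h : ℤ) * (j + 1) ≤ h * (n * m) := mul_le_mul_of_nonneg_left hj' hh
    have h2 : (0 : ℤ) ≤ (n * m) * (2 * h * k + k) := by positivity
    nlinarith
  · have hj' : (j : ℤ) ≤ (n : ℤ) * k * m := by exact_mod_cast hj
    have h0 : (0 : ℤ) ≤ h * (n * m - 1) := mul_nonneg hh (by linarith)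
    refine ⟨by nlinarith [mul_nonneg hh (Int.natCast_nonneg j)], ?_⟩
    have h1 : (2 * (h : ℤ) + 1) * j ≤ (2 * h + 1) * (n * k * m) :=
      mul_le_mul_of_nonneg_left hj' (by linarith)
    nlinarith

theorem blockD_sep {n h m k : ℕ} {x y : ℤ} (hx : x ∈ blockD n h m k) (hy : y ∈ blockD n h m k)
    (hxy : x < y) : x + 2 * h ≤ y := by
  have hh : (0 : ℤ) ≤ h := Int.natCast_nonneg h
  simp only [blockD, Finset.mem_union, Finset.mem_image, Finset.mem_range, Finset.mem_Icc]
    at hx hy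
  rcases hx with ⟨i, hi, rfl⟩ | ⟨i, ⟨hi1, hi⟩, rfl⟩ <;>
    rcases hy with ⟨j, hj, rfl⟩ | ⟨j, ⟨hj1, hj⟩, rfl⟩
  · have h1 : (i : ℤ) < j := lt_of_mul_lt_mul_left hxy (by linarith)
    have h2 : (i : ℤ) + 1 ≤ j := h1
    nlinarith
  · have hi' : (i : ℤ) + 1 ≤ (n : ℤ) * m := by exact_mod_cast hi
    have hj' : (1 : ℤ) ≤ j := by exact_mod_cast hj1
    nlinarith
  · exfalso
    have hj' : (j : ℤ) + 1 ≤ (n : ℤ) * m := by exact_mod_cast hj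
    have hi' : (1 : ℤ) ≤ i := by exact_mod_cast hi1
    nlinarith
  · have h1 : (i : ℤ) < j := by
      refine lt_of_mul_lt_mul_left (a := 2 * (h : ℤ) + 1) (by linarith) (by linarith)
    have h2 : (i : ℤ) + 1 ≤ j := h1
    nlinarith

theorem nextH_inr (n h : ℕ) (b : Function.periodicPts v) (k : ℕ+) :
    nextH v n h (.inr (b, k)) = n ^ 2 * nextZ v n h (.inr (b, k)) := by
  have : (k : ℕ) * (n ^ 3 * (k + 1) * per v b) / (k + 1) = k * n ^ 3 * per v b := by
    rw [show (k : ℕ) * (n ^ 3 * (k + 1) * per v b) = k * n ^ 3 * per v b * (k + 1) by ring]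
    exact Nat.mul_div_cancel _ (Nat.succ_pos _)
  simp only [nextH, nextZ, nextR, this]
  ring

theorem nextC_bounds {n h : ℕ} (hn : 0 < n) (l : CellLabel v) {x : ℤ} (hx : x ∈ nextC v n h l) :
    0 ≤ x ∧ x + 2 * h ≤ (nextH v n h l : ℤ) := by
  have hh : (0 : ℤ) ≤ h := Int.natCast_nonneg h
  rcases l with a | ⟨b, k⟩
  · simp only [nextC, Finset.mem_image, Finset.mem_range] at hx
    obtain ⟨j, hj, rfl⟩ := hx
    have hj' : (j : ℤ) + 1 ≤ (nextR v n (.inl a) : ℤ) := by exact_mod_cast hj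
    refine ⟨by positivity, ?_⟩
    simp only [nextH]
    push_cast
    nlinarith
  · simp only [nextC, Finset.mem_image, Finset.mem_product, Finset.mem_range] at hx
    obtain ⟨⟨d, q⟩, ⟨hd, hq⟩, rfl⟩ := hx
    obtain ⟨h1, h2⟩ := blockD_bounds hn (per_pos v b) hd
    have hz : ((per v b * n * (2 * h * (k + 1) + k) : ℕ) : ℤ) = nextZ v n h (.inr (b, k)) := rfl
    rw [hz] at h2
    rw [nextH_inr]
    have hq' : (q : ℤ) + 1 ≤ (n : ℤ) ^ 2 := by exact_mod_cast hq
    have hz0 : (0 : ℤ) ≤ nextZ v n h (.inr (b, k)) := Int.natCast_nonneg _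
    refine ⟨by positivity, ?_⟩
    push_cast
    nlinarith

theorem nextC_sep {n h : ℕ} (hn : 0 < n) (l : CellLabel v) {x y : ℤ} (hx : x ∈ nextC v n h l)
    (hy : y ∈ nextC v n h l) (hxy : x < y) : x + 2 * h ≤ y := by
  have hh : (0 : ℤ) ≤ h := Int.natCast_nonneg h
  rcases l with a | ⟨b, k⟩
  · simp only [nextC, Finset.mem_image, Finset.mem_range] at hx hy
    obtain ⟨i, hi, rfl⟩ := hx
    obtain ⟨j, hj, rfl⟩ := hy
    have h1 : (i : ℤ) < j := lt_of_mul_lt_mul_left hxy (by linarith)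
    have h2 : (i : ℤ) + 1 ≤ j := h1
    nlinarith
  · simp only [nextC, Finset.mem_image, Finset.mem_product, Finset.mem_range] at hx hy
    obtain ⟨⟨d, q⟩, ⟨hd, hq⟩, rfl⟩ := hx
    obtain ⟨⟨e, r⟩, ⟨he, hr⟩, rfl⟩ := hy
    obtain ⟨d1, d2⟩ := blockD_bounds hn (per_pos v b) hd
    obtain ⟨e1, e2⟩ := blockD_bounds hn (per_pos v b) he
    have hz : ((per v b * n * (2 * h * (k + 1) + k) : ℕ) : ℤ) = nextZ v n h (.inr (b, k)) := rfl
    rw [hz] at d2 e2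
    have hz0 : (0 : ℤ) ≤ nextZ v n h (.inr (b, k)) := Int.natCast_nonneg _
    simp only at hxy hd he d1 d2 e1 e2 ⊢
    rcases lt_trichotomy q r with h1 | rfl | h1
    · have h2 : (q : ℤ) + 1 ≤ r := by exact_mod_cast h1
      nlinarith
    · have := blockD_sep hd he (by linarith)
      linarith
    · exfalso
      have h2 : (r : ℤ) + 1 ≤ q := by exact_mod_cast h1
      nlinarith

theorem zero_mem_nextC {n h : ℕ} (hn : 0 < n) (l : CellLabel v) : 0 ∈ nextC v n h l := by
  rcases l with a | ⟨b, k⟩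
  · simp only [nextC, Finset.mem_image, Finset.mem_range]
    exact ⟨0, Nat.mul_pos (pow_pos hn 3) (per_pos v a), by simp⟩
  · simp only [nextC, Finset.mem_image, Finset.mem_product, Finset.mem_range]
    refine ⟨(0, 0), ⟨?_, pow_pos hn 2⟩, by simp⟩
    simp only [blockD, Finset.mem_union, Finset.mem_image, Finset.mem_range]
    exact Or.inl ⟨0, Nat.mul_pos hn (per_pos v b), by simp⟩

theorem one_lt_card_nextC {n h : ℕ} (hn : 1 < n) (hh : 0 < h) (l : CellLabel v) :
    1 < (nextC v n h l).card := by
  have hn0 : 0 < n := by omega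
  have hh' : (0 : ℤ) < h := by exact_mod_cast hh
  refine Finset.one_lt_card.2 ⟨0, zero_mem_nextC v hn0 l, ?_⟩
  rcases l with a | ⟨b, k⟩
  · refine ⟨2 * h, ?_, by linarith⟩
    simp only [nextC, Finset.mem_image, Finset.mem_range]
    refine ⟨1, ?_, by simp⟩
    exact lt_of_lt_of_le (Nat.one_lt_pow (by norm_num) hn) (Nat.le_mul_of_pos_right _ (per_pos v a))
  · have h1 : (1 : ℤ) ≤ (n : ℤ) * per v b := by exact_mod_cast Nat.mul_pos hn0 (per_pos v b)
    refine ⟨(2 * (h : ℤ) + 1) * (1 : ℕ) + 2 * h * ((n : ℤ) * per v b - 1), ?_, ?_⟩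
    · simp only [nextC, Finset.mem_image, Finset.mem_product, Finset.mem_range]
      refine ⟨((2 * (h : ℤ) + 1) * (1 : ℕ) + 2 * h * ((n : ℤ) * per v b - 1), 0),
        ⟨?_, pow_pos hn0 2⟩, by simp⟩
      simp only [blockD, Finset.mem_union, Finset.mem_image, Finset.mem_Icc]
      exact Or.inr ⟨1, ⟨le_rfl, Nat.mul_pos (Nat.mul_pos hn0 k.pos) (per_pos v b)⟩, rfl⟩
    · push_cast
      nlinarith

theorem card_nextC_le (n h : ℕ) (l : CellLabel v) : (nextC v n h l).card ≤ nextR v n l := by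
  rcases l with a | ⟨b, k⟩
  · exact Finset.card_image_le.trans (by simp)
  · refine Finset.card_image_le.trans ?_
    rw [Finset.card_product, Finset.card_range]
    have h1 : (blockD n h (per v b) k).card ≤ n * per v b + n * k * per v b := by
      refine (Finset.card_union_le _ _).trans (add_le_add ?_ ?_)
      · exact Finset.card_image_le.trans (by simp)
      · exact Finset.card_image_le.trans (by simp)
    refine (Nat.mul_le_mul_right _ h1).trans (le_of_eq ?_)
    simp only [nextR]
    ring

theorem le_nextH (n h : ℕ) (l : CellLabel v) : 2 * nextR v n l * h ≤ nextH v n h l := by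
  rcases l with a | ⟨b, k⟩
  · exact le_rfl
  · exact Nat.le_add_right _ _

/-- The choices from which the sequence `(C_n, h_n)` is built. -/
structure SpecialChoice where
  /-- The partition of `ℕ = {1, 2, …}`: `label n` is the cell containing `n`. -/
  label : ℕ → CellLabel v
  /-- Every cell is infinite. -/
  label_infinite : ∀ l, {n : ℕ | 1 ≤ n ∧ label n = l}.Infinite
  /-- The initial height `h_1`. -/
  h₁ : ℕ
  /-- The initial set `C_1`. -/
  C₁ : Finset ℤ
  zero_mem : 0 ∈ C₁
  subset : C₁ ⊆ Finset.Ico (0 : ℤ) h₁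

namespace SpecialChoice

variable {v} (P : SpecialChoice v)

/-- The heights `h_n`: `h_0 = 1`, the given `h_1`, then inductively. -/
def h : ℕ → ℕ
  | 0 => 1
  | 1 => P.h₁
  | n + 2 => nextH v (n + 1) (h (n + 1)) (P.label (n + 2))

/-- The sets `C_n`: the given `C_1`, then inductively (`C_0 = {0}` is a convention). -/
def C : ℕ → Finset ℤ
  | 0 => {0}
  | 1 => P.C₁
  | n + 2 => nextC v (n + 1) (P.h (n + 1)) (P.label (n + 2))

/-- The integers `z_n` for `n ≥ 2` (`z_0` and `z_1` are not used). -/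
def z : ℕ → ℕ
  | 0 => 0
  | 1 => 0
  | n + 2 => nextZ v (n + 1) (P.h (n + 1)) (P.label (n + 2))

theorem zero_mem_C (n : ℕ) : 0 ∈ P.C n := by
  match n with
  | 0 => simp [C]
  | 1 => exact P.zero_mem
  | n + 2 => exact zero_mem_nextC v (Nat.succ_pos n) _

theorem h_pos (n : ℕ) : 0 < P.h n := by
  match n with
  | 0 => simp [h]
  | 1 =>
    have := P.subset P.zero_mem
    simp only [Finset.mem_Ico] at this
    simp only [h]
    omega
  | n + 2 =>
    have hn : 0 < n + 1 := Nat.succ_pos n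
    have := (nextC_bounds v (h := P.h (n + 1)) hn (P.label (n + 2)) (zero_mem_nextC v hn _)).2
    have h1 := h_pos (n + 1)
    simp only [h]
    omega

theorem card_mul_le (n : ℕ) : 2 * ((P.C (n + 2)).card * P.h (n + 1)) ≤ P.h (n + 2) := by
  have h1 := card_nextC_le v (n + 1) (P.h (n + 1)) (P.label (n + 2))
  have h2 := le_nextH v (n + 1) (P.h (n + 1)) (P.label (n + 2))
  simp only [h, C]
  calc _ ≤ 2 * (nextR v (n + 1) (P.label (n + 2)) * P.h (n + 1)) := by gcongr
    _ ≤ _ := by rw [← mul_assoc]; exact h2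

theorem pow_mul_prod_le (n : ℕ) :
    2 ^ n * ∏ j ∈ Finset.Icc 1 (n + 1), (P.C j).card ≤ P.C₁.card * P.h (n + 1) := by
  induction n with
  | zero => simpa [C] using Nat.le_mul_of_pos_right _ (P.h_pos 1)
  | succ n ih =>
    rw [Finset.prod_Icc_succ_top (by omega)]
    calc 2 ^ (n + 1) * ((∏ j ∈ Finset.Icc 1 (n + 1), (P.C j).card) * (P.C (n + 2)).card)
        = 2 * (P.C (n + 2)).card * (2 ^ n * ∏ j ∈ Finset.Icc 1 (n + 1), (P.C j).card) := by ring
      _ ≤ 2 * (P.C (n + 2)).card * (P.C₁.card * P.h (n + 1)) := Nat.mul_le_mul_left _ ih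
      _ = P.C₁.card * (2 * ((P.C (n + 2)).card * P.h (n + 1))) := by ring
      _ ≤ _ := Nat.mul_le_mul_left _ (P.card_mul_le n)

/-- The sequence `(C_{n+1}, F_n)_{n ≥ 0}` built from the given choices. -/
def toCFData : CFData where
  h := P.h
  C := P.C
  h_zero := rfl
  zero_mem := P.zero_mem_C
  one_lt_card := by
    filter_upwards [eventually_ge_atTop 3] with n hn
    obtain ⟨m, rfl⟩ : ∃ m, n = m + 2 := ⟨n - 2, by omega⟩
    exact one_lt_card_nextC v (by omega) (P.h_pos _) _
  add_mem := by
    intro n f hf c hc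
    match n with
    | 0 =>
      have h1 := P.subset hc
      simp only [h, Finset.mem_Ico] at hf h1 ⊢
      omega
    | n + 1 =>
      have h1 := nextC_bounds v (show 0 < n + 1 from Nat.succ_pos n) _ hc
      simp only [Finset.mem_Ico] at hf ⊢
      change _ ∧ _ < ((nextH v (n + 1) (P.h (n + 1)) (P.label (n + 2)) : ℕ) : ℤ)
      omega
  disjoint := by
    intro n f hf f' hf' c hc c' hc' hne heq
    match n with
    | 0 =>
      simp only [h, Finset.mem_Ico] at hf hf'
      omega
    | n + 1 =>
      simp only [Finset.mem_Ico] at hf hf'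
      rcases lt_or_gt_of_ne hne with h1 | h1
      · have := nextC_sep v (Nat.succ_pos n) _ hc hc' h1
        omega
      · have := nextC_sep v (Nat.succ_pos n) _ hc' hc h1
        omega
  tendsto_ratio := by
    have hpos : ∀ n, 0 < (P.C n).card := fun n => Finset.card_pos.2 ⟨0, P.zero_mem_C n⟩
    have h1 : (0 : ℝ) < P.C₁.card := by exact_mod_cast hpos 1
    rw [← tendsto_add_atTop_iff_nat 1]
    refine tendsto_atTop_mono (f := fun n : ℕ => (2 : ℝ) ^ n / P.C₁.card) (fun n => ?_)
      ((tendsto_pow_atTop_atTop_of_one_lt one_lt_two).atTop_div_const h1)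
    have h2 : (0 : ℝ) < ∏ j ∈ Finset.Icc 1 (n + 1), ((P.C j).card : ℝ) :=
      Finset.prod_pos fun j _ => by exact_mod_cast hpos j
    rw [div_le_div_iff₀ h1 h2, mul_comm (P.h (n + 1) : ℝ)]
    exact_mod_cast P.pow_mul_prod_le n

variable [AddCommGroup K]

/-- The requirements on the maps `α_{n+1} : C_{n+1} → K`, for all `n ≥ 1`. -/
structure Admissible (α : ℕ → ℤ → K) : Prop where
  /-- In both cases: `α_{n+1}(c + z_{n+1}) = v(α_{n+1}(c))` for `c ∈ C_{n+1} ∩ (C_{n+1} - z_{n+1})`. -/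
  shift : ∀ n, 1 ≤ n → ∀ c ∈ P.C (n + 1), c + P.z (n + 1) ∈ P.C (n + 1) →
    α (n + 1) (c + P.z (n + 1)) = v (α (n + 1) c)
  /-- The condition on the increments over `2h_n` when `n + 1 ∈ N_a`. -/
  incrN : ∀ n, 1 ≤ n → ∀ a : Function.periodicPts v, P.label (n + 1) = .inl a →
    ∀ i < per v a, ∃ S ⊆ P.C (n + 1),
      (∀ c ∈ S, c - 2 * P.h n ∈ P.C (n + 1) ∧
        α (n + 1) c = α (n + 1) (c - 2 * P.h n) + v^[i] a) ∧
      |(S.card : ℝ) / (P.C (n + 1)).card - 1 / per v a| < 2 / (n * per v a)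
  /-- The condition on the increments over `2h_n` when `n + 1 ∈ M_{b,k}`. -/
  incrM : ∀ n, 1 ≤ n → ∀ (b : Function.periodicPts v) (k : ℕ+), P.label (n + 1) = .inr (b, k) →
    ∀ i < per v b, ∃ S ⊆ P.C (n + 1),
      (∀ c ∈ S, c - 2 * P.h n ∈ P.C (n + 1) ∧
        α (n + 1) c = α (n + 1) (c - 2 * P.h n) + v^[i] b) ∧
      |(S.card : ℝ) / (P.C (n + 1)).card - 1 / ((k + 1) * per v b)| < 2 / (n * per v b)
  /-- The condition on the increments over `2h_n + 1` when `n + 1 ∈ M_{b,k}`. -/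
  constM : ∀ n, 1 ≤ n → ∀ (b : Function.periodicPts v) (k : ℕ+), P.label (n + 1) = .inr (b, k) →
    ∃ S ⊆ P.C (n + 1),
      (∀ c ∈ S, c - 2 * P.h n - 1 ∈ P.C (n + 1) ∧
        α (n + 1) c = α (n + 1) (c - 2 * P.h n - 1)) ∧
      |(S.card : ℝ) / (P.C (n + 1)).card - k / (k + 1)| < 2 / n

end SpecialChoice

end Special

end

/-! Why `T^{×p} × T_α` is ergodic.

Write `[f]_n` for the cylinder of the points of `X_n` with `f_n = f`. Below the top of the tower,
`T` maps `[f]_n` onto `[f + 1]_n`, and the skew product adds to the coordinate in `K` a constant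
that depends only on `n` and `f` (`CFData.T_mem_cyl`, `CFData.cocycle_T`, `CFData.height`). As the
cylinders generate the σ-algebra of `X`, this determines the action of `T` completely; in particular
`T` preserves `μ`.

Let `n + 1` belong to the cell `M_{b,1}`. A definite proportion of `C_{n+1}` consists of elements
`c` such that `c - 2h_n ∈ C_{n+1}` and `α_{n+1}` grows by `b` from `c - 2h_n` to `c`; another one
of elements `c` such that `c - 2h_n - 1 ∈ C_{n+1}` and `α_{n+1}` takes the same value at both.
Starting from a point of the first kind, `T^{2h_n}` does not change `f_n` and the skew product adds
`b`; starting from a point of the second kind, `f_n` decreases by one. In the product of `p + 1`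
factors, the two kinds can be prescribed independently in every factor. Consequently `2h_n` steps of
`T^{×p} × T_α` imitate, on a definite proportion of each set which is measurable with respect to
level `n`, the inverse of any map `T^{δ_1} × ⋯ × T^{δ_p} × T_α^{δ_{p+1}}` with `δ_i ∈ {0, 1}`,
composed with the translation by `b` if `δ_{p+1} = 0`
(`SpecialChoice.measure_inter_preimage_delayMap_le`). Approximating an invariant set `A` by such
level sets, one finds that `A` is almost invariant under all these maps
(`SpecialChoice.measure_inter_preimage_delayMap_compl`). The single family of cells `M_{b,1}`,
`b ∈ 𝒦`, is enough for this.

So the restriction `ρ` of the measure to `A` is invariant under `T` in each coordinate, under `T_α`,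
and under the translations of `K` by a dense set of elements. The first two make the measures that
`ρ` induces on `K` above the boxes of one level translates of each other, and the third makes them
multiples of the Haar measure (`SpecialChoice.exists_restrict_box_eq`). Hence `ρ` is a multiple of
the product measure, with a factor that does not depend on the level, and since `ρ` vanishes on the
complement of `A`, either `A` or its complement is null (`SpecialChoice.ergodic_prodMap`).
-/

noncomputable section

namespace CFData

variable (D : CFData)

/-! ### Points of `X` and cylinders -/

/-- The entry `c_j` of `y = (f_n, c_{n+1}, …) ∈ X_n`, with the convention `c_j = 0` for `j ≤ n`. -/
def digit {n : ℕ} (y : D.Level n) (j : ℕ) : ℤ := if h : n < j then (y.2 ⟨j, h⟩ : ℤ) else 0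

/-- The entry `f_m` of the point `y ∈ X_n`, rewritten as an element of `X_m`, `m ≥ n`. -/
def pos {n : ℕ} (y : D.Level n) (m : ℕ) : ℤ := y.1 + ∑ j ∈ Finset.Ioc n m, D.digit y j

variable {D}

theorem digit_of_lt {n : ℕ} (y : D.Level n) {j : ℕ} (h : n < j) : D.digit y j = y.2 ⟨j, h⟩ :=
  dif_pos h

theorem digit_of_le {n : ℕ} (y : D.Level n) {j : ℕ} (h : j ≤ n) : D.digit y j = 0 :=
  dif_neg (by omega)

theorem digit_mem {n : ℕ} (y : D.Level n) {j : ℕ} (h : n < j) : D.digit y j ∈ D.C j := by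
  rw [digit_of_lt y h]; exact (y.2 ⟨j, h⟩).2

theorem pos_self {n : ℕ} (y : D.Level n) : D.pos y n = y.1 := by simp [pos]

theorem pos_succ {n m : ℕ} (h : n ≤ m) (y : D.Level n) :
    D.pos y (m + 1) = D.pos y m + D.digit y (m + 1) := by
  rw [pos, Finset.sum_Ioc_succ_top h, pos, add_assoc]

theorem pos_mem {n m : ℕ} (h : n ≤ m) (y : D.Level n) : D.pos y m ∈ D.F m := by
  induction m, h using Nat.le_induction with
  | base => rw [pos_self]; exact y.1.2
  | succ m h ih =>
    rw [pos_succ h]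
    exact D.add_mem m _ ih _ (digit_mem y (by omega))

/-- The embedding of `X_n` into `X_m`, `n ≤ m`. -/
def push {n m : ℕ} (h : n ≤ m) (y : D.Level n) : D.Level m :=
  (⟨D.pos y m, pos_mem h y⟩, fun j => y.2 ⟨j, lt_of_le_of_lt h j.2⟩)

theorem level_ext {n : ℕ} {y y' : D.Level n} (h1 : (y.1 : ℤ) = y'.1)
    (h2 : ∀ j, n < j → D.digit y j = D.digit y' j) : y = y' := by
  refine Prod.ext (Subtype.ext h1) (funext fun j => Subtype.ext ?_)
  have := h2 j j.2
  rwa [digit_of_lt y j.2, digit_of_lt y' j.2] at this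

theorem digit_push {n m : ℕ} (h : n ≤ m) (y : D.Level n) {j : ℕ} (hj : m < j) :
    D.digit (push h y) j = D.digit y j := by
  rw [digit_of_lt _ hj, digit_of_lt _ (lt_of_le_of_lt h hj)]; rfl

theorem digit_incl {n : ℕ} (y : D.Level n) {j : ℕ} (hj : n + 1 < j) :
    D.digit (D.incl n y) j = D.digit y j := by
  rw [digit_of_lt _ hj, digit_of_lt _ (by omega)]; rfl

theorem ι_incl (n : ℕ) (y : D.Level n) : D.ι (n + 1) (D.incl n y) = D.ι n y :=
  (Quot.sound (r := D.Glue) (a := ⟨n, y⟩) rfl).symm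

theorem ι_push {n m : ℕ} (h : n ≤ m) (y : D.Level n) : D.ι m (push h y) = D.ι n y := by
  induction m, h using Nat.le_induction with
  | base => congr 1; exact level_ext (pos_self y) fun j hj => digit_push _ y hj
  | succ m h ih =>
    rw [← ih, ← ι_incl m (push h y)]
    refine congrArg (D.ι (m + 1)) (level_ext ?_ fun j hj => ?_)
    · change D.pos y (m + 1) = D.pos y m + _
      rw [pos_succ h, digit_of_lt y (by omega : n < m + 1)]
      rfl
    · rw [digit_push _ y hj, digit_incl _ hj, digit_push h y (by omega)]

/-- The germ at infinity of `m ↦ f_m`. Being unchanged by the embeddings, it is defined on `X`. -/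
def germ (D : CFData) : D.X → Filter.Germ (atTop : Filter ℕ) ℤ :=
  Quot.lift (fun s => ((fun m => D.pos s.2 m : ℕ → ℤ) : Filter.Germ atTop ℤ)) <| by
    rintro ⟨n, y⟩ _ rfl
    refine Filter.Germ.coe_eq.2 ?_
    filter_upwards [eventually_ge_atTop (n + 1)] with m hm
    induction m, hm using Nat.le_induction with
    | base =>
      rw [pos_self, pos_succ le_rfl, pos_self, digit_of_lt y (by omega : n < n + 1)]; rfl
    | succ m h ih =>
      rw [pos_succ (by omega), pos_succ h]
      exact congrArg₂ _ ih (digit_incl y (by omega)).symm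

/-- Decompositions `f_m = f_n + c_{n+1} + ⋯ + c_m` are unique. -/
theorem eq_of_pos_eq {n : ℕ} {y y' : D.Level n} {m : ℕ} (h : n ≤ m) (he : D.pos y m = D.pos y' m) :
    (y.1 : ℤ) = y'.1 ∧ ∀ j, j ≤ m → D.digit y j = D.digit y' j := by
  induction m, h using Nat.le_induction with
  | base =>
    rw [pos_self, pos_self] at he
    exact ⟨he, fun j hj => by rw [digit_of_le _ hj, digit_of_le _ hj]⟩
  | succ m h ih =>
    rw [pos_succ h, pos_succ h] at he
    have hd : D.digit y (m + 1) = D.digit y' (m + 1) := by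
      by_contra hne
      exact D.disjoint m _ (pos_mem h y) _ (pos_mem h y') _ (digit_mem y (by omega)) _
        (digit_mem y' (by omega)) hne he
    obtain ⟨h1, h2⟩ := ih (by rw [hd] at he; linarith)
    refine ⟨h1, fun j hj => ?_⟩
    rcases hj.lt_or_eq with hj | rfl
    · exact h2 j (by omega)
    · exact hd

theorem ι_injective (n : ℕ) : Function.Injective (D.ι n) := by
  intro y y' h
  have hg : (fun m => D.pos y m : ℕ → ℤ) =ᶠ[atTop] fun m => D.pos y' m :=
    Filter.Germ.coe_eq.1 (congrArg D.germ h)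
  obtain ⟨M, hM⟩ := eventually_atTop.1 hg
  have key := fun j => eq_of_pos_eq (m := max n (max M j)) (le_max_left _ _) (hM _ (by omega))
  exact level_ext (key 0).1 fun j _ => (key j).2 j (by omega)

theorem push_eq {n m : ℕ} (h : n ≤ m) {y : D.Level n} {z : D.Level m} (he : D.ι n y = D.ι m z) :
    push h y = z := ι_injective m ((ι_push h y).trans he)

/-- If `z ∈ X_m` has the same entry `f_m` as `y ∈ X_n`, then `z` comes from the point of `X_n`
that agrees with `y` up to the index `m`, and with `z` beyond it. -/
theorem exists_splice {n m : ℕ} (h : n ≤ m) (y : D.Level n) (z : D.Level m)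
    (hz : (z.1 : ℤ) = D.pos y m) :
    ∃ y' : D.Level n, D.ι n y' = D.ι m z ∧ y'.1 = y.1 ∧ ∀ j ≤ m, D.digit y' j = D.digit y j := by
  classical
  let y' : D.Level n := (y.1, fun j => if hj : m < j then z.2 ⟨j, hj⟩ else y.2 j)
  have hd : ∀ j ≤ m, D.digit y' j = D.digit y j := by
    intro j hj
    by_cases hn : n < j
    · rw [digit_of_lt _ hn, digit_of_lt _ hn]
      simp [y', hj]
    · rw [digit_of_le _ (by omega), digit_of_le _ (by omega)]
  refine ⟨y', ?_, rfl, hd⟩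
  rw [← ι_push h]
  congr 1
  refine level_ext ?_ fun j hj => ?_
  · rw [hz]
    change D.pos y' m = _
    exact congrArg (_ + ·) (Finset.sum_congr rfl fun j hj => hd j (Finset.mem_Ioc.1 hj).2)
  · rw [digit_push h y' hj, digit_of_lt _ (lt_of_le_of_lt h hj), digit_of_lt _ hj]
    simp [y', hj]

/-- The cylinder `[f]_n` of the points `(f_n, c_{n+1}, …)` of `X_n` with `f_n = f`. It is empty
unless `f ∈ F_n`. -/
def Cyl (D : CFData) (n : ℕ) (f : ℤ) : Set D.X := {x | ∃ y : D.Level n, D.ι n y = x ∧ (y.1 : ℤ) = f}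

theorem mem_F_of_mem_cyl {n : ℕ} {f : ℤ} {x : D.X} (h : x ∈ D.Cyl n f) : f ∈ D.F n := by
  obtain ⟨y, -, rfl⟩ := h
  exact y.1.2

theorem zero_mem_F (h : ∀ n, 0 < D.h n) (n : ℕ) : 0 ∈ D.F n := by
  have := h n
  simp [F, this]

theorem cyl_nonempty {n : ℕ} {f : ℤ} (h : f ∈ D.F n) : (D.Cyl n f).Nonempty :=
  ⟨D.ι n (⟨f, h⟩, fun m => ⟨0, D.zero_mem m⟩), _, rfl, rfl⟩

theorem cyl_unique {n : ℕ} {f f' : ℤ} {x : D.X} (h : x ∈ D.Cyl n f) (h' : x ∈ D.Cyl n f') :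
    f = f' := by
  obtain ⟨y, hy, rfl⟩ := h
  obtain ⟨y', hy', rfl⟩ := h'
  rw [ι_injective n (hy.trans hy'.symm)]

theorem ι_mem_cyl_iff {n m : ℕ} (h : n ≤ m) (y : D.Level n) (f : ℤ) :
    D.ι n y ∈ D.Cyl m f ↔ D.pos y m = f := by
  refine ⟨fun ⟨z, hz, hf⟩ => ?_, fun hf => ⟨push h y, ι_push h y, hf⟩⟩
  rw [← hf, ← push_eq h hz.symm]; rfl

theorem cyl_subset_cyl {n m : ℕ} (h : n ≤ m) {f g : ℤ} {x : D.X} (hf : x ∈ D.Cyl n f)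
    (hg : x ∈ D.Cyl m g) : D.Cyl m g ⊆ D.Cyl n f := by
  rintro _ ⟨z, rfl, rfl⟩
  obtain ⟨y, rfl, rfl⟩ := hf
  rw [ι_mem_cyl_iff h] at hg
  obtain ⟨y', h1, h2, -⟩ := exists_splice h y z hg.symm
  exact ⟨y', h1, by rw [h2]⟩

theorem exists_mem_cyl_of_le {n m : ℕ} (h : n ≤ m) {f : ℤ} {x : D.X} (hf : x ∈ D.Cyl n f) :
    ∃ g, x ∈ D.Cyl m g := by
  obtain ⟨y, rfl, rfl⟩ := hf
  exact ⟨_, (ι_mem_cyl_iff h y _).2 rfl⟩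

theorem exists_mem_cyl (x : D.X) : ∃ n f, x ∈ D.Cyl n f := by
  obtain ⟨n, y, rfl⟩ := D.exists_rep x
  exact ⟨n, _, y, rfl, rfl⟩

theorem cyl_add_subset {n : ℕ} {f c : ℤ} (hf : f ∈ D.F n) (hc : c ∈ D.C (n + 1)) :
    D.Cyl (n + 1) (f + c) ⊆ D.Cyl n f := by
  classical
  let y : D.Level n := (⟨f, hf⟩, fun j => if hj : (j : ℕ) = n + 1 then ⟨c, hj ▸ hc⟩
    else ⟨0, D.zero_mem j⟩)
  refine cyl_subset_cyl (Nat.le_succ n) (x := D.ι n y) ⟨y, rfl, rfl⟩ ?_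
  rw [ι_mem_cyl_iff (Nat.le_succ n), pos_succ le_rfl, pos_self, digit_of_lt y (by omega)]
  simp [y]

theorem exists_mem_cyl_add {n : ℕ} {f : ℤ} {x : D.X} (hx : x ∈ D.Cyl n f) :
    ∃ c ∈ D.C (n + 1), x ∈ D.Cyl (n + 1) (f + c) := by
  obtain ⟨y, rfl, rfl⟩ := hx
  refine ⟨_, digit_mem y (Nat.lt_succ_self n), ?_⟩
  rw [ι_mem_cyl_iff (Nat.le_succ n), pos_succ le_rfl, pos_self]

theorem mem_range_ι {n : ℕ} {x : D.X} : x ∈ Set.range (D.ι n) ↔ ∃ f, x ∈ D.Cyl n f :=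
  ⟨fun ⟨y, hy⟩ => ⟨_, y, hy, rfl⟩, fun ⟨_, y, hy, _⟩ => ⟨y, hy⟩⟩

/-! ### The topology and the σ-algebra of `X` -/

theorem continuous_digit (n j : ℕ) : Continuous fun y : D.Level n => D.digit y j := by
  by_cases h : n < j
  · simp only [digit, h, dif_pos]
    fun_prop
  · simp only [digit, h, dif_neg, not_false_eq_true]
    fun_prop

theorem continuous_pos (n m : ℕ) : Continuous fun y : D.Level n => D.pos y m := by
  unfold pos
  exact (continuous_subtype_val.comp continuous_fst).add
    (continuous_finsetSum _ fun j _ => continuous_digit n j)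

theorem continuous_ι (n : ℕ) : Continuous (D.ι n) :=
  continuous_quot_mk.comp continuous_sigmaMk

theorem isOpen_cyl (n : ℕ) (f : ℤ) : IsOpen (D.Cyl n f) := by
  refine (isOpen_coinduced (f := Quot.mk D.Glue)).2 (isOpen_sigma_iff.2 fun m => ?_)
  change IsOpen (D.ι m ⁻¹' D.Cyl n f)
  rcases le_total m n with h | h
  · have : D.ι m ⁻¹' D.Cyl n f = (fun y => D.pos y n) ⁻¹' {f} := by
      ext y; exact ι_mem_cyl_iff h y f
    rw [this]
    exact (isOpen_discrete _).preimage (continuous_pos m n)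
  · have : D.ι m ⁻¹' D.Cyl n f =
        (fun y => D.pos y m) ⁻¹' {g | g ∈ D.F m ∧ D.Cyl m g ⊆ D.Cyl n f} := by
      ext y
      have hy : D.ι m y ∈ D.Cyl m (D.pos y m) := (ι_mem_cyl_iff le_rfl y _).2 rfl
      exact ⟨fun hx => ⟨pos_mem le_rfl y, cyl_subset_cyl h hx hy⟩, fun hx => hx.2 hy⟩
    rw [this]
    exact (isOpen_discrete _).preimage (continuous_pos m m)

/-- The cylinders are a basis of the topology. -/
theorem exists_cyl_subset {U : Set D.X} (hU : IsOpen U) {x : D.X} (hx : x ∈ U) :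
    ∃ n f, x ∈ D.Cyl n f ∧ D.Cyl n f ⊆ U := by
  obtain ⟨n, y, rfl⟩ := D.exists_rep x
  have hV : IsOpen (D.ι n ⁻¹' U) := hU.preimage (continuous_ι n)
  obtain ⟨u, hu, v, hv, huv⟩ := mem_nhds_prod_iff.1 (hV.mem_nhds hx)
  obtain ⟨v', hv', hvo, hyv⟩ := mem_nhds_iff.1 hv
  obtain ⟨I, w, hw, hsub⟩ := isOpen_pi_iff.1 hvo _ hyv
  set m := max n (I.sup fun j => (j : ℕ)) with hm
  have hnm : n ≤ m := le_max_left _ _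
  refine ⟨m, D.pos y m, (ι_mem_cyl_iff hnm y _).2 rfl, ?_⟩
  rintro _ ⟨z, rfl, hz⟩
  obtain ⟨y', h1, h2, h3⟩ := exists_splice hnm y z hz
  rw [← h1]
  refine huv (Set.mk_mem_prod ?_ (hv' (hsub fun j hj => ?_)))
  · rw [h2]; exact mem_of_mem_nhds hu
  · have hjm : (j : ℕ) ≤ m :=
      (Finset.le_sup (f := fun j : Set.Ioi n => (j : ℕ)) (Finset.mem_coe.1 hj)).trans
        (le_max_right _ _)
    have := h3 j hjm
    rw [digit_of_lt _ j.2, digit_of_lt _ j.2] at this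
    rw [show y'.2 j = y.2 j from Subtype.ext this]
    exact (hw j hj).2

/-- The family of all cylinders. -/
def cylinders (D : CFData) : Set (Set D.X) := Set.range fun q : ℕ × ℤ => D.Cyl q.1 q.2

theorem isTopologicalBasis_cylinders : TopologicalSpace.IsTopologicalBasis D.cylinders := by
  refine TopologicalSpace.isTopologicalBasis_of_isOpen_of_nhds ?_ fun x U hx hU => ?_
  · rintro _ ⟨q, rfl⟩
    exact isOpen_cyl _ _
  · obtain ⟨n, f, h1, h2⟩ := exists_cyl_subset hU hx
    exact ⟨_, ⟨(n, f), rfl⟩, h1, h2⟩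

instance : SecondCountableTopology D.X :=
  isTopologicalBasis_cylinders.secondCountableTopology (Set.countable_range _)

theorem measurableSpace_eq : (inferInstance : MeasurableSpace D.X) =
    MeasurableSpace.generateFrom D.cylinders :=
  isTopologicalBasis_cylinders.borel_eq_generateFrom

theorem measurableSet_cyl (n : ℕ) (f : ℤ) : MeasurableSet (D.Cyl n f) :=
  (isOpen_cyl n f).measurableSet

theorem measurable_ι (n : ℕ) : Measurable (D.ι n) := (continuous_ι n).measurable

/-! ### The measure of a cylinder -/

/-- The common measure `(#C_1 ⋯ #C_n)⁻¹` of the nonempty cylinders `[f]_n`. -/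
def w (D : CFData) (n : ℕ) : ENNReal := (∏ j ∈ Finset.Icc 1 n, ((D.C j).card : ENNReal))⁻¹

theorem card_pos (n : ℕ) : 0 < (D.C n).card := Finset.card_pos.2 ⟨0, D.zero_mem n⟩

theorem card_ne_zero (n : ℕ) : ((D.C n).card : ENNReal) ≠ 0 := by
  exact_mod_cast (card_pos n).ne'

theorem prod_card_ne_zero (s : Finset ℕ) : ∏ j ∈ s, ((D.C j).card : ENNReal) ≠ 0 :=
  Finset.prod_ne_zero_iff.2 fun j _ => card_ne_zero j

theorem prod_card_ne_top (s : Finset ℕ) : ∏ j ∈ s, ((D.C j).card : ENNReal) ≠ ⊤ :=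
  ENNReal.prod_ne_top fun _ _ => ENNReal.natCast_ne_top _

theorem w_ne_zero (n : ℕ) : D.w n ≠ 0 := ENNReal.inv_ne_zero.2 (prod_card_ne_top _)

theorem w_ne_top (n : ℕ) : D.w n ≠ ⊤ := ENNReal.inv_ne_top.2 (prod_card_ne_zero _)

theorem w_zero : D.w 0 = 1 := by simp [w]

theorem w_succ (n : ℕ) : D.w n = (D.C (n + 1)).card * D.w (n + 1) := by
  rw [w, w, Finset.prod_Icc_succ_top (by omega), mul_comm (Finset.prod _ _),
    ENNReal.mul_inv (Or.inl (card_ne_zero _)) (Or.inl (ENNReal.natCast_ne_top _)), ← mul_assoc,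
    ENNReal.mul_inv_cancel (card_ne_zero _) (ENNReal.natCast_ne_top _), one_mul]

/-- In the coordinates of `X_k`, `k ≤ n`, a cylinder `[f]_n` fixes `f_k` and `c_{k+1}, …, c_n`. -/
theorem levelMeasure_preimage_cyl {k n : ℕ} (h : k ≤ n) {f : ℤ} (y : D.Level k)
    (hy : D.ι k y ∈ D.Cyl n f) : D.levelMeasure k (D.ι k ⁻¹' D.Cyl n f) = D.w n := by
  classical
  rw [ι_mem_cyl_iff h] at hy
  have hset : D.ι k ⁻¹' D.Cyl n f = {y.1} ×ˢ
      Set.pi (((Finset.Ioc k n).subtype (· ∈ Set.Ioi k) : Finset (Set.Ioi k)) : Set (Set.Ioi k))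
        (fun j => {y.2 j}) := by
    ext y'
    simp only [Set.mem_preimage, ι_mem_cyl_iff h, Set.mem_prod, Set.mem_singleton_iff, Set.mem_pi,
      Finset.mem_coe, Finset.mem_subtype, Finset.mem_Ioc]
    constructor
    · intro h'
      obtain ⟨h1, h2⟩ := eq_of_pos_eq h (h'.trans hy.symm)
      refine ⟨Subtype.ext h1, fun j hj => Subtype.ext ?_⟩
      have := h2 j hj.2
      rwa [digit_of_lt _ j.2, digit_of_lt _ j.2] at this
    · rintro ⟨h1, h2⟩
      rw [← hy, pos, pos, h1]
      congr 1
      refine Finset.sum_congr rfl fun j hj => ?_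
      have hj := Finset.mem_Ioc.1 hj
      rw [digit_of_lt _ hj.1, digit_of_lt _ hj.1, h2 ⟨j, hj.1⟩ hj]
  rw [hset, levelMeasure, Measure.smul_apply, Measure.prod_prod, Measure.count_singleton, one_mul,
    Measure.infinitePi_pi _ (fun _ _ => MeasurableSet.singleton _), smul_eq_mul]
  have h1 : ∀ j : Set.Ioi k, (PMF.uniformOfFintype (D.C j)).toMeasure {y.2 j} =
      ((D.C j).card : ENNReal)⁻¹ := by
    intro j
    rw [PMF.toMeasure_apply_singleton _ _ (MeasurableSet.singleton _), PMF.uniformOfFintype_apply,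
      Fintype.card_coe]
  have hunion : Finset.Icc 1 n = Finset.Icc 1 k ∪ Finset.Ioc k n := by
    ext j; simp only [Finset.mem_Icc, Finset.mem_union, Finset.mem_Ioc]; omega
  have hdisj : Disjoint (Finset.Icc 1 k) (Finset.Ioc k n) := by
    rw [Finset.disjoint_left]
    intro j; simp only [Finset.mem_Icc, Finset.mem_Ioc]; omega
  simp_rw [h1]
  rw [Finset.prod_subtype_of_mem (p := (· ∈ Set.Ioi k)) (fun j : ℕ => ((D.C j).card : ENNReal)⁻¹)
      (fun j hj => (Finset.mem_Ioc.1 hj).1), w, hunion, Finset.prod_union hdisj,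
    ENNReal.mul_inv (Or.inl (prod_card_ne_zero _)) (Or.inl (prod_card_ne_top _)),
    ENNReal.prod_inv_distrib (s := Finset.Ioc k n) fun i _ j _ _ => Or.inl (card_ne_zero _)]

/-- A cylinder `[f]_n` lies in a single piece `X_k \ (X_0 ∪ ⋯ ∪ X_{k-1})` of the definition of
`μ`, so its measure is given by `levelMeasure k`. -/
theorem mu_cyl {n : ℕ} {f : ℤ} (hf : f ∈ D.F n) : D.μ (D.Cyl n f) = D.w n := by
  classical
  obtain ⟨x, hx⟩ := cyl_nonempty hf
  have hex : ∃ k, x ∈ Set.range (D.ι k) := ⟨n, mem_range_ι.2 ⟨f, hx⟩⟩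
  set k := Nat.find hex with hk
  have hkn : k ≤ n := Nat.find_min' hex (mem_range_ι.2 ⟨f, hx⟩)
  have hdich : ∀ i ≤ n, x ∈ Set.range (D.ι i) → D.Cyl n f ⊆ Set.range (D.ι i) := by
    intro i hi hxi
    obtain ⟨g, hg⟩ := mem_range_ι.1 hxi
    exact fun x' hx' => mem_range_ι.2 ⟨g, cyl_subset_cyl hi hg hx hx'⟩
  have hsub : D.Cyl n f ⊆ disjointed (fun i => Set.range (D.ι i)) k := by
    intro x' hx'
    rw [disjointed_apply]
    refine ⟨hdich k hkn (Nat.find_spec hex) hx', ?_⟩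
    simp only [Finset.sup_eq_iSup, Set.iSup_eq_iUnion, Set.mem_iUnion]
    rintro ⟨i, hi, hxi⟩
    have hi := Finset.mem_Iio.1 hi
    obtain ⟨g, hg⟩ := mem_range_ι.1 hxi
    exact Nat.find_min hex hi
      (mem_range_ι.2 ⟨g, cyl_subset_cyl (hi.le.trans hkn) hg hx' hx⟩)
  rw [μ, Measure.sum_apply _ (measurableSet_cyl n f), tsum_eq_single k]
  · rw [Measure.restrict_apply (measurableSet_cyl n f), Set.inter_eq_left.2 hsub,
      Measure.map_apply (measurable_ι k) (measurableSet_cyl n f)]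
    obtain ⟨y, hy⟩ := Nat.find_spec hex
    exact levelMeasure_preimage_cyl hkn y (hy ▸ hx)
  · intro i hi
    rw [Measure.restrict_apply (measurableSet_cyl n f)]
    have : D.Cyl n f ∩ disjointed (fun i => Set.range (D.ι i)) i = ∅ :=
      ((disjoint_disjointed (fun i => Set.range (D.ι i)) hi.symm).mono_left hsub).inter_eq
    rw [this, measure_empty]

theorem cyl_eq_empty {n : ℕ} {f : ℤ} (hf : f ∉ D.F n) : D.Cyl n f = ∅ :=
  Set.eq_empty_of_forall_notMem fun _ hx => hf (mem_F_of_mem_cyl hx)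

theorem mu_cyl_le (n : ℕ) (f : ℤ) : D.μ (D.Cyl n f) ≤ D.w n := by
  by_cases hf : f ∈ D.F n
  · exact (mu_cyl hf).le
  · simp [cyl_eq_empty hf]

theorem mu_cyl_lt_top (n : ℕ) (f : ℤ) : D.μ (D.Cyl n f) < ⊤ :=
  (mu_cyl_le n f).trans_lt (w_ne_top n).lt_top

instance : SigmaFinite D.μ := by
  refine ⟨⟨⟨fun k => ⋃ q ∈ (Finset.range k ×ˢ Finset.Icc (-(k : ℤ)) k : Finset (ℕ × ℤ)),
    D.Cyl q.1 q.2, fun _ => trivial, fun k => ?_, ?_⟩⟩⟩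
  · exact measure_biUnion_lt_top (Finset.finite_toSet _) fun q _ => mu_cyl_lt_top _ _
  · refine Set.eq_univ_of_forall fun x => ?_
    obtain ⟨n, f, hx⟩ := exists_mem_cyl x
    refine Set.mem_iUnion.2 ⟨max (n + 1) f.natAbs, Set.mem_iUnion₂.2 ⟨(n, f), ?_, hx⟩⟩
    simp only [Finset.mem_product, Finset.mem_range, Finset.mem_Icc]
    omega

/-! ### The transformation on cylinders -/

theorem mem_F_iff {n : ℕ} {f : ℤ} : f ∈ D.F n ↔ 0 ≤ f ∧ f < D.h n := Finset.mem_Ico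

/-- Adding `1` at level `n`, whenever possible, and passing to a higher level commute. -/
theorem ι_add_one_eq {n m : ℕ} {y : D.Level n} {z : D.Level m} (he : D.ι n y = D.ι m z)
    (hy : (y.1 : ℤ) + 1 ∈ D.F n) (hz : (z.1 : ℤ) + 1 ∈ D.F m) :
    D.ι n (⟨_, hy⟩, y.2) = D.ι m (⟨_, hz⟩, z.2) := by
  wlog h : n ≤ m generalizing n m
  · exact (this he.symm hz hy (by omega)).symm
  have hd : ∀ j, D.digit (n := n) (⟨_, hy⟩, y.2) j = D.digit y j := fun j => rfl
  have hp : ∀ j, D.pos (n := n) (⟨_, hy⟩, y.2) j = D.pos y j + 1 := by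
    intro j; simp only [pos, hd]; ring
  rw [← ι_push h]
  have hpz := push_eq h he
  congr 1
  refine level_ext ?_ fun j hj => ?_
  · change D.pos _ m = (z.1 : ℤ) + 1
    rw [hp, ← hpz]; rfl
  · rw [digit_push h _ hj, hd, ← digit_push h y hj, hpz]; rfl

theorem T_ι {n : ℕ} (y : D.Level n) (hy : (y.1 : ℤ) + 1 ∈ D.F n) :
    D.T (D.ι n y) = D.ι n (⟨_, hy⟩, y.2) := by
  have H : ∃ (m : ℕ) (z : D.Level m), D.ι m z = D.ι n y ∧ (z.1 : ℤ) + 1 ∈ D.F m := ⟨n, y, rfl, hy⟩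
  rw [T, dif_pos H]
  exact ι_add_one_eq H.choose_spec.choose_spec.1 _ hy

theorem T_mem_cyl {n : ℕ} {f : ℤ} {x : D.X} (hx : x ∈ D.Cyl n f) (hf : f + 1 ∈ D.F n) :
    D.T x ∈ D.Cyl n (f + 1) := by
  obtain ⟨y, rfl, rfl⟩ := hx
  rw [T_ι y hf]
  exact ⟨_, rfl, rfl⟩

/-- The property that `T` is defined at every point by the formula `f_n ↦ f_n + 1`. -/
def IsTotal (D : CFData) : Prop := ∀ x : D.X, ∃ n f, x ∈ D.Cyl n f ∧ f + 1 ∈ D.F n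

theorem mem_F_succ_of_le {n m : ℕ} (h : n ≤ m) {f g : ℤ} {x : D.X} (hf : x ∈ D.Cyl n f)
    (hg : x ∈ D.Cyl m g) (h1 : f + 1 ∈ D.F n) : g + 1 ∈ D.F m := by
  obtain ⟨k, hk⟩ := exists_mem_cyl_of_le h (T_mem_cyl hf h1)
  obtain ⟨y, rfl, rfl⟩ := hf
  rw [T_ι y h1, ι_mem_cyl_iff h] at hk
  rw [ι_mem_cyl_iff h] at hg
  have : k = g + 1 := by
    rw [← hk, ← hg, pos, pos]
    have hd : ∀ j, D.digit (n := n) (⟨_, h1⟩, y.2) j = D.digit y j := fun j => rfl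
    simp only [hd]; ring
  rw [← this, ← hk]
  exact pos_mem h _

theorem mem_cyl_of_T_mem (hD : D.IsTotal) {n : ℕ} {f : ℤ} (hf : 0 ≤ f) {x : D.X}
    (hx : D.T x ∈ D.Cyl n (f + 1)) : x ∈ D.Cyl n f := by
  obtain ⟨m₀, g₀, hx₀, hg₀⟩ := hD x
  have hm : n ≤ max n m₀ := le_max_left _ _
  obtain ⟨g, hxg⟩ := exists_mem_cyl_of_le (le_max_right n m₀) hx₀
  have hg : g + 1 ∈ D.F (max n m₀) := mem_F_succ_of_le (le_max_right n m₀) hx₀ hxg hg₀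
  have hT := T_mem_cyl hxg hg
  obtain ⟨y, hy, hyf⟩ := hx
  have hf' : f ∈ D.F n := by
    have := mem_F_iff.1 y.1.2
    rw [mem_F_iff]; omega
  rw [← hy, ι_mem_cyl_iff hm] at hT
  have hd : ∀ j, D.digit (n := n) (⟨f, hf'⟩, y.2) j = D.digit y j := fun j => rfl
  have hp : D.pos (n := n) (⟨f, hf'⟩, y.2) (max n m₀) = g := by
    have : D.pos (n := n) (⟨f, hf'⟩, y.2) (max n m₀) + 1 = D.pos y (max n m₀) := by
      simp only [pos, hd]; rw [hyf]; ring
    linarith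
  exact cyl_subset_cyl hm (x := D.ι n (⟨f, hf'⟩, y.2)) ⟨_, rfl, rfl⟩
    ((ι_mem_cyl_iff hm _ _).2 hp) hxg

theorem preimage_T_cyl (hD : D.IsTotal) {n : ℕ} {f : ℤ} (hf : 0 ≤ f) (hf' : f + 1 ∈ D.F n) :
    D.T ⁻¹' D.Cyl n (f + 1) = D.Cyl n f :=
  Set.Subset.antisymm (fun _ hx => mem_cyl_of_T_mem hD hf hx) fun _ hx => T_mem_cyl hx hf'

/-- The point `(0, 0, …)` of `X_0`: the only point of `X` without a preimage under `T`. -/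
def origin (D : CFData) : D.X :=
  D.ι 0 (⟨0, by simp [F, D.h_zero]⟩, fun m => ⟨0, D.zero_mem m⟩)

theorem origin_mem_cyl (n : ℕ) : D.origin ∈ D.Cyl n 0 := by
  rw [origin, ι_mem_cyl_iff (Nat.zero_le n), pos]
  simp only [zero_add]
  refine Finset.sum_eq_zero fun j hj => ?_
  rw [digit_of_lt _ (Finset.mem_Ioc.1 hj).1]

theorem exists_mem_cyl_pos {x : D.X} (hx : x ≠ D.origin) (N : ℕ) :
    ∃ n f, N ≤ n ∧ 0 < f ∧ x ∈ D.Cyl n f := by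
  obtain ⟨n, y, rfl⟩ := D.exists_rep x
  by_contra! hcon
  have hzero : ∀ m ≥ max n N, D.pos y m = 0 := by
    intro m hm
    have hnm : n ≤ m := (le_max_left _ _).trans hm
    by_contra hne
    have h0 := (mem_F_iff.1 (pos_mem hnm y)).1
    exact hcon m (D.pos y m) ((le_max_right _ _).trans hm) (lt_of_le_of_ne h0 (Ne.symm hne))
      ((ι_mem_cyl_iff hnm y _).2 rfl)
  apply hx
  have ho : D.origin = D.ι n (push (Nat.zero_le n) (⟨0, by simp [F, D.h_zero]⟩,
      fun m => ⟨0, D.zero_mem m⟩)) := (ι_push _ _).symm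
  rw [ho]
  set o := push (Nat.zero_le n) ((⟨0, by simp [F, D.h_zero]⟩,
      fun m => ⟨0, D.zero_mem m⟩) : D.Level 0) with ho'
  have hpo : ∀ m, n ≤ m → D.pos o m = 0 := fun m hm => by
    rw [← ι_mem_cyl_iff hm, ← ho]; exact origin_mem_cyl m
  have key := fun j => eq_of_pos_eq (y := y) (y' := o) (m := max j (max n N)) (by omega)
    (by rw [hzero _ (by omega), hpo _ (by omega)])
  rw [level_ext (key 0).1 fun j _ => (key j).2 j (by omega)]

theorem T_ne_origin (hD : D.IsTotal) (x : D.X) : D.T x ≠ D.origin := by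
  obtain ⟨n, f, hx, hf⟩ := hD x
  intro he
  have h1 := cyl_unique (T_mem_cyl hx hf) (he ▸ origin_mem_cyl n)
  have h2 := (mem_F_iff.1 (mem_F_of_mem_cyl hx)).1
  omega

/-- The cylinders `[f]_n` with `f > 0`, together with the origin: a generating family of sets whose
preimages under `T` are known. The preimage of `[0]_n` is not a single cylinder. -/
def posCylinders (D : CFData) : Set (Set D.X) :=
  {s | ∃ n f, 0 < f ∧ f ∈ D.F n ∧ s = D.Cyl n f} ∪ {{D.origin}}

theorem measurableSet_origin : MeasurableSet {D.origin} := by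
  have : {D.origin} = (⋃ (n : ℕ) (f : ℤ) (_ : 0 < f), D.Cyl n f)ᶜ := by
    ext x
    simp only [Set.mem_singleton_iff, Set.mem_compl_iff, Set.mem_iUnion, not_exists]
    refine ⟨?_, fun h => ?_⟩
    · rintro rfl n f hf hx
      have := cyl_unique hx (origin_mem_cyl n)
      omega
    · by_contra hne
      obtain ⟨n, f, -, hf, hx⟩ := exists_mem_cyl_pos hne 0
      exact h n f hf hx
  rw [this]
  exact (MeasurableSet.iUnion fun n => MeasurableSet.iUnion fun f => MeasurableSet.iUnion fun _ =>
    measurableSet_cyl n f).compl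

theorem measurableSpace_eq_posCylinders : (inferInstance : MeasurableSpace D.X) =
    MeasurableSpace.generateFrom D.posCylinders := by
  refine le_antisymm ?_ (MeasurableSpace.generateFrom_le ?_)
  · rw [measurableSpace_eq]
    refine MeasurableSpace.generateFrom_le ?_
    rintro _ ⟨⟨n, f⟩, rfl⟩
    have hbase : ∀ m g, 0 < g → MeasurableSet[MeasurableSpace.generateFrom D.posCylinders]
        (D.Cyl m g) := by
      intro m g hg
      by_cases hgF : g ∈ D.F m
      · exact MeasurableSpace.measurableSet_generateFrom (Or.inl ⟨m, g, hg, hgF, rfl⟩)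
      · rw [cyl_eq_empty hgF]; exact @MeasurableSet.empty _ (_)
    have horigin : MeasurableSet[MeasurableSpace.generateFrom D.posCylinders] {D.origin} :=
      MeasurableSpace.measurableSet_generateFrom (Or.inr rfl)
    have heq : D.Cyl n f = (⋃ (m : ℕ) (g : ℤ) (_ : 0 < g ∧ D.Cyl m g ⊆ D.Cyl n f), D.Cyl m g) ∪
        (⋃ (_ : D.origin ∈ D.Cyl n f), {D.origin}) := by
      ext x
      simp only [Set.mem_union, Set.mem_iUnion, Set.mem_singleton_iff]
      refine ⟨fun hx => ?_, ?_⟩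
      · by_cases hne : x = D.origin
        · exact Or.inr ⟨hne ▸ hx, hne⟩
        · obtain ⟨m, g, hm, hg, hxg⟩ := exists_mem_cyl_pos hne n
          exact Or.inl ⟨m, g, ⟨hg, cyl_subset_cyl hm hx hxg⟩, hxg⟩
      · rintro (⟨m, g, ⟨-, hs⟩, hx⟩ | ⟨ho, rfl⟩)
        · exact hs hx
        · exact ho
    change MeasurableSet[MeasurableSpace.generateFrom D.posCylinders] (D.Cyl n f)
    rw [heq]
    refine @MeasurableSet.union _ (_) _ _ (@MeasurableSet.iUnion _ _ (_) _ _ fun m =>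
      @MeasurableSet.iUnion _ _ (_) _ _ fun g => @MeasurableSet.iUnion _ _ (_) _ _ fun hg =>
        hbase m g hg.1) (@MeasurableSet.iUnion _ _ (_) _ _ fun _ => horigin)
  · rintro _ (⟨n, f, -, -, rfl⟩ | rfl)
    · exact measurableSet_cyl n f
    · exact measurableSet_origin

theorem isPiSystem_posCylinders : IsPiSystem D.posCylinders := by
  have hnot : ∀ {n : ℕ} {f : ℤ}, 0 < f → D.origin ∉ D.Cyl n f := fun hf h => by
    have := cyl_unique h (origin_mem_cyl _); omega
  rintro _ (⟨n, f, hf, hfF, rfl⟩ | rfl) _ (⟨m, g, hg, hgF, rfl⟩ | rfl) ⟨x, h1, h2⟩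
  · rcases le_total n m with h | h
    · rw [Set.inter_eq_right.2 (cyl_subset_cyl h h1 h2)]
      exact Or.inl ⟨m, g, hg, hgF, rfl⟩
    · rw [Set.inter_eq_left.2 (cyl_subset_cyl h h2 h1)]
      exact Or.inl ⟨n, f, hf, hfF, rfl⟩
  · rw [Set.mem_singleton_iff.1 h2] at h1
    exact absurd h1 (hnot hf)
  · rw [Set.mem_singleton_iff.1 h1] at h2
    exact absurd h2 (hnot hg)
  · rw [Set.inter_self]
    exact Or.inr rfl

theorem measurable_T (hD : D.IsTotal) : Measurable D.T := by
  suffices h : ∀ s ∈ D.posCylinders, MeasurableSet (D.T ⁻¹' s) from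
    fun s hs => by
      rw [show MeasurableSet s ↔ MeasurableSet[MeasurableSpace.generateFrom D.posCylinders] s from
        by rw [← measurableSpace_eq_posCylinders]] at hs
      exact @measurable_generateFrom _ _ _ _ D.T h s hs
  rintro _ (⟨n, f, hf, hfF, rfl⟩ | rfl)
  · obtain ⟨f, rfl⟩ : ∃ g, f = g + 1 := ⟨f - 1, by ring⟩
    rw [preimage_T_cyl hD (by omega) hfF]
    exact measurableSet_cyl n f
  · have : D.T ⁻¹' {D.origin} = ∅ := Set.eq_empty_of_forall_notMem fun x hx => T_ne_origin hD x hx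
    rw [this]
    exact MeasurableSet.empty

theorem tendsto_w : Tendsto D.w atTop (𝓝 0) := by
  obtain ⟨N, hN⟩ := eventually_atTop.1 D.one_lt_card
  have hle : ∀ k, D.w (N + k) ≤ D.w N * (2⁻¹ : ENNReal) ^ k := by
    intro k
    induction k with
    | zero => simp
    | succ k ih =>
      have h2 : (2 : ENNReal) ≤ (D.C (N + k + 1)).card := by
        exact_mod_cast hN (N + k + 1) (by omega)
      have h3 : 2 * D.w (N + k + 1) ≤ D.w (N + k) := by
        rw [w_succ (N + k)]; gcongr
      calc D.w (N + (k + 1)) = 2⁻¹ * (2 * D.w (N + k + 1)) := by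
            rw [← mul_assoc, ENNReal.inv_mul_cancel (by simp) (by simp), one_mul, add_assoc]
        _ ≤ 2⁻¹ * (D.w N * 2⁻¹ ^ k) := mul_le_mul_right (h3.trans ih) _
        _ = _ := by rw [pow_succ]; ring
  have h0 : Tendsto (fun k : ℕ => D.w N * (2⁻¹ : ENNReal) ^ k) atTop (𝓝 0) := by
    have := ENNReal.Tendsto.const_mul (a := D.w N)
      (ENNReal.tendsto_pow_atTop_nhds_zero_of_lt_one (r := 2⁻¹) (by simp))
      (Or.inr (w_ne_top N))
    rwa [mul_zero] at this
  have h1 : Tendsto (fun k => D.w (k + N)) atTop (𝓝 0) :=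
    tendsto_of_tendsto_of_tendsto_of_le_of_le tendsto_const_nhds h0 (fun _ => zero_le)
      fun k => by rw [add_comm]; exact hle k
  exact (tendsto_add_atTop_iff_nat N).1 h1

theorem mu_origin : D.μ {D.origin} = 0 := by
  refine le_antisymm (ge_of_tendsto' (tendsto_w (D := D)) fun n => ?_) zero_le
  exact (measure_mono (Set.singleton_subset_iff.2 (origin_mem_cyl n))).trans (mu_cyl_le n 0)

theorem measurePreserving_T (hD : D.IsTotal) : MeasurePreserving D.T D.μ D.μ := by
  refine ⟨measurable_T hD, ?_⟩
  have hto : D.T ⁻¹' {D.origin} = ∅ := Set.eq_empty_of_forall_notMem fun x hx => T_ne_origin hD x hx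
  have hT : ∀ s ∈ D.posCylinders, (D.μ.map D.T) s = D.μ s := by
    rintro _ (⟨n, f, hf, hfF, rfl⟩ | rfl)
    · obtain ⟨f, rfl⟩ : ∃ g, f = g + 1 := ⟨f - 1, by ring⟩
      have hf0 : f ∈ D.F n := by rw [mem_F_iff] at hfF ⊢; omega
      rw [Measure.map_apply (measurable_T hD) (measurableSet_cyl _ _),
        preimage_T_cyl hD (by omega) hfF, mu_cyl hfF, mu_cyl hf0]
    · rw [Measure.map_apply (measurable_T hD) measurableSet_origin, hto, measure_empty, mu_origin]
  refine Measure.ext_of_generateFrom_of_cover_subset measurableSpace_eq_posCylinders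
    isPiSystem_posCylinders subset_rfl ?_ ?_ ?_ hT
  · refine Set.Countable.union ?_ (Set.countable_singleton _)
    refine (Set.countable_range fun q : ℕ × ℤ => D.Cyl q.1 q.2).mono ?_
    rintro _ ⟨n, f, -, -, rfl⟩
    exact ⟨(n, f), rfl⟩
  · refine Set.eq_univ_of_forall fun x => ?_
    by_cases hx : x = D.origin
    · exact ⟨_, Or.inr rfl, hx⟩
    · obtain ⟨n, f, -, hf, hxf⟩ := exists_mem_cyl_pos hx 0
      exact ⟨_, Or.inl ⟨n, f, hf, mem_F_of_mem_cyl hxf, rfl⟩, hxf⟩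
  · intro s hs
    rw [hT s hs]
    rcases hs with ⟨n, f, -, -, rfl⟩ | rfl
    · exact (mu_cyl_lt_top n f).ne
    · rw [mu_origin]; exact ENNReal.zero_ne_top

/-! ### The cocycle on cylinders -/

theorem ι_rep (x : D.X) : D.ι (D.lev x) (D.rep x) = x := by
  classical
  exact (Nat.find_spec (D.exists_rep x)).choose_spec

theorem lev_le {n : ℕ} {f : ℤ} {x : D.X} (hx : x ∈ D.Cyl n f) : D.lev x ≤ n := by
  classical
  obtain ⟨y, hy, -⟩ := hx
  exact Nat.find_min' (D.exists_rep x) ⟨y, hy⟩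

theorem lev_le_of_ι {n : ℕ} (y : D.Level n) : D.lev (D.ι n y) ≤ n := lev_le ⟨y, rfl, rfl⟩

theorem toZero_eq_digit (x : D.X) (m : Set.Ioi 0) :
    ((D.toZero x).2 m : ℤ) = D.digit (D.rep x) m := by
  simp only [toZero, digit]
  split_ifs <;> rfl

theorem digit_rep_of_lt {n j : ℕ} (y : D.Level n) (hj : n < j) :
    D.digit (D.rep (D.ι n y)) j = D.digit y j := by
  have h := lev_le_of_ι y
  rw [← digit_push h _ hj, push_eq h (ι_rep (D.ι n y))]

theorem digit_rep_eq {k : ℕ} {x : D.X} (hk : k = D.lev x) (y : D.Level k) (hy : D.ι k y = x)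
    (j : ℕ) : D.digit (D.rep x) j = D.digit y j := by
  subst hk
  rw [ι_injective _ (hy.trans (ι_rep x).symm)]

/-- The entries of `π x` up to the index `n` depend only on the cylinder `[f]_n` containing `x`. -/
theorem digit_rep_congr {n : ℕ} {f : ℤ} {x x' : D.X} (hx : x ∈ D.Cyl n f) (hx' : x' ∈ D.Cyl n f)
    {j : ℕ} (hj : j ≤ n) : D.digit (D.rep x) j = D.digit (D.rep x') j := by
  have key : ∀ {x x' : D.X}, x ∈ D.Cyl n f → x' ∈ D.Cyl n f →
      ∃ y : D.Level (D.lev x), D.ι _ y = x' ∧ ∀ j ≤ n, D.digit y j = D.digit (D.rep x) j := by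
    intro x x' hx hx'
    obtain ⟨z, hz, hzf⟩ := hx'
    have hp : D.pos (D.rep x) n = f := by rw [← ι_mem_cyl_iff (lev_le hx), ι_rep]; exact hx
    obtain ⟨y, h1, -, h2⟩ := exists_splice (lev_le hx) (D.rep x) z (hzf.trans hp.symm)
    exact ⟨y, h1.trans hz, h2⟩
  obtain ⟨y, h1, h2⟩ := key hx hx'
  obtain ⟨y', h1', -⟩ := key hx' hx
  have hle : D.lev x' ≤ D.lev x := h1 ▸ lev_le_of_ι y
  have hle' : D.lev x ≤ D.lev x' := by
    have := lev_le_of_ι y'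
    rwa [h1'] at this
  rw [digit_rep_eq (le_antisymm hle' hle) y h1, h2 j hj]

variable {K : Type*} [AddCommGroup K]

open Classical in
/-- The sum `∑_{0 < j ≤ n} α_j(c_j)`, where `(0, c_1, c_2, …) = π x` for any `x` in the cylinder
`[f]_n`: the part of the cocycle that is determined by `f_n = f`. -/
def height (D : CFData) (α : ℕ → ℤ → K) (n : ℕ) (f : ℤ) : K :=
  if h : (D.Cyl n f).Nonempty then ∑ j ∈ Finset.Icc 1 n, α j (D.digit (D.rep h.some) j) else 0

theorem height_eq (α : ℕ → ℤ → K) {n : ℕ} {f : ℤ} {x : D.X} (hx : x ∈ D.Cyl n f) :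
    D.height α n f = ∑ j ∈ Finset.Icc 1 n, α j (D.digit (D.rep x) j) := by
  have h : (D.Cyl n f).Nonempty := ⟨x, hx⟩
  rw [height, dif_pos h]
  exact Finset.sum_congr rfl fun j hj => by
    rw [digit_rep_congr h.some_mem hx (Finset.mem_Icc.1 hj).2]

theorem height_add (α : ℕ → ℤ → K) {n : ℕ} {f c : ℤ} (hf : f ∈ D.F n) (hc : c ∈ D.C (n + 1)) :
    D.height α (n + 1) (f + c) = D.height α n f + α (n + 1) c := by
  obtain ⟨x, hx⟩ := cyl_nonempty (D.add_mem n f hf c hc)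
  have hx' := cyl_add_subset hf hc hx
  rw [height_eq α hx, height_eq α hx', Finset.sum_Icc_succ_top (by omega)]
  congr 2
  obtain ⟨y, rfl, rfl⟩ := hx'
  rw [digit_rep_of_lt y (Nat.lt_succ_self n)]
  rw [ι_mem_cyl_iff (Nat.le_succ n), pos_succ le_rfl, pos_self] at hx
  linarith

theorem cocycle_T (α : ℕ → ℤ → K) {n : ℕ} {f : ℤ} {x : D.X} (hx : x ∈ D.Cyl n f)
    (hf : f + 1 ∈ D.F n) :
    D.cocycle α (D.T x) x = D.height α n (f + 1) - D.height α n f := by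
  rw [height_eq α hx, height_eq α (T_mem_cyl hx hf), ← Finset.sum_sub_distrib]
  simp only [cocycle, toZero_eq_digit]
  have h1 := finsum_set_coe_eq_finsum_mem (Set.Ioi 0)
    (f := fun m : ℕ => α m (D.digit (D.rep (D.T x)) m) - α m (D.digit (D.rep x) m))
  rw [h1]
  refine finsum_mem_eq_sum_of_inter_support_eq _ ?_
  ext m
  simp only [Set.mem_inter_iff, Set.mem_Ioi, Function.mem_support, Finset.coe_Icc, Set.mem_Icc]
  refine ⟨fun ⟨h0, hne⟩ => ⟨⟨h0, ?_⟩, hne⟩, fun ⟨⟨h0, _⟩, hne⟩ => ⟨h0, hne⟩⟩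
  by_contra hm
  apply hne
  obtain ⟨y, rfl, rfl⟩ := hx
  rw [T_ι y hf, digit_rep_of_lt y (by omega), digit_rep_of_lt _ (by omega : n < m)]
  exact sub_self _

theorem iterate_mem_cyl (α : ℕ → ℤ → K) {n : ℕ} {f : ℤ} (k : ℕ) {x : D.X} (hx : x ∈ D.Cyl n f)
    (hf : f + k ∈ D.F n) : D.T^[k] x ∈ D.Cyl n (f + k) ∧
      ∀ g, (D.skew α)^[k] (x, g) = (D.T^[k] x, D.height α n (f + k) - D.height α n f + g) := by
  induction k with
  | zero => simpa using hx
  | succ k ih =>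
    have h0 := (mem_F_iff.1 (mem_F_of_mem_cyl hx)).1
    have hk : f + k ∈ D.F n := by
      rw [mem_F_iff] at hf ⊢; push_cast at hf; omega
    have hk1 : f + k + 1 ∈ D.F n := by rwa [Nat.cast_succ, ← add_assoc] at hf
    obtain ⟨h1, h2⟩ := ih hk
    rw [Nat.cast_succ, ← add_assoc, Function.iterate_succ_apply']
    refine ⟨T_mem_cyl h1 hk1, fun g => ?_⟩
    rw [Function.iterate_succ_apply', h2, skew]
    simp only [Prod.mk.injEq, true_and]
    rw [cocycle_T α h1 hk1]
    abel

theorem measurable_cocycle [MeasurableSpace K] (hD : D.IsTotal) (α : ℕ → ℤ → K) :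
    Measurable fun x => D.cocycle α (D.T x) x := by
  intro s _
  have : (fun x => D.cocycle α (D.T x) x) ⁻¹' s = ⋃ (n : ℕ) (f : ℤ)
      (_ : f + 1 ∈ D.F n ∧ D.height α n (f + 1) - D.height α n f ∈ s), D.Cyl n f := by
    ext x
    simp only [Set.mem_preimage, Set.mem_iUnion]
    refine ⟨fun h => ?_, ?_⟩
    · obtain ⟨n, f, hx, hf⟩ := hD x
      exact ⟨n, f, ⟨hf, by rwa [← cocycle_T α hx hf]⟩, hx⟩
    · rintro ⟨n, f, ⟨hf, h⟩, hx⟩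
      rwa [cocycle_T α hx hf]
  rw [this]
  exact MeasurableSet.iUnion fun n => MeasurableSet.iUnion fun f => MeasurableSet.iUnion fun _ =>
    measurableSet_cyl n f

theorem measurePreserving_skew [MeasurableSpace K] [MeasurableAdd₂ K] (lam : Measure K)
    [SFinite lam] [lam.IsAddLeftInvariant] (hD : D.IsTotal) (α : ℕ → ℤ → K) :
    MeasurePreserving (D.skew α) (D.μ.prod lam) (D.μ.prod lam) := by
  refine (measurePreserving_T hD).skew_product (g := fun x k => D.cocycle α (D.T x) x + k) ?_ ?_
  · exact ((measurable_cocycle hD α).comp measurable_fst).add measurable_snd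
  · exact ae_of_all _ fun x => (measurePreserving_add_left lam _).map_eq

end CFData

/-! ### Return times of the special sequences -/

namespace SpecialChoice

variable {K : Type*} {v : K → K} (P : SpecialChoice v)

theorem add_two_mul_h_le {n : ℕ} (hn : 1 ≤ n) {c : ℤ} (hc : c ∈ P.C (n + 1)) :
    0 ≤ c ∧ c + 2 * P.h n ≤ P.h (n + 1) := by
  obtain ⟨n, rfl⟩ : ∃ k, n = k + 1 := ⟨n - 1, by omega⟩
  exact nextC_bounds v (Nat.succ_pos n) _ hc

theorem C_sep {n : ℕ} (hn : 1 ≤ n) {c c' : ℤ} (hc : c ∈ P.C (n + 1)) (hc' : c' ∈ P.C (n + 1))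
    (h : c < c') : c + 2 * P.h n ≤ c' := by
  obtain ⟨n, rfl⟩ : ∃ k, n = k + 1 := ⟨n - 1, by omega⟩
  exact nextC_sep v (Nat.succ_pos n) _ hc hc' h

theorem isTotal : P.toCFData.IsTotal := by
  intro x
  obtain ⟨n, f, hx⟩ := CFData.exists_mem_cyl x
  obtain ⟨g, hg⟩ := CFData.exists_mem_cyl_of_le (Nat.le_succ n) hx
  obtain ⟨c, hc, hxc⟩ := CFData.exists_mem_cyl_add hg
  refine ⟨_, _, hxc, ?_⟩
  have h1 := CFData.mem_F_iff.1 (CFData.mem_F_of_mem_cyl hg)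
  have h2 := P.add_two_mul_h_le (n := n + 1) (by omega) hc
  have h3 := P.h_pos (n + 1)
  rw [CFData.mem_F_iff]
  change 0 ≤ g + c + 1 ∧ g + c + 1 < P.h (n + 1 + 1)
  have h1' : 0 ≤ g ∧ g < P.h (n + 1) := h1
  omega

theorem eq_add_one_of_T_mem {n : ℕ} (hn : 1 ≤ n) {f f' : ℤ} {x : P.toCFData.X}
    (hx : x ∈ P.toCFData.Cyl n f) (hT : P.toCFData.T x ∈ P.toCFData.Cyl n f') : f' = f + 1 := by
  by_cases hf : f + 1 ∈ P.toCFData.F n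
  · exact CFData.cyl_unique hT (CFData.T_mem_cyl hx hf)
  rcases lt_or_ge 0 f' with h0 | h0
  · have := CFData.mem_cyl_of_T_mem P.isTotal (f := f' - 1) (by omega) (by simpa using hT)
    have := CFData.cyl_unique hx this
    omega
  -- The remaining case `f' = 0`, `f = h_n - 1` contradicts the gaps between elements of `C_{n+1}`.
  exfalso
  have hf0 := CFData.mem_F_iff.1 (CFData.mem_F_of_mem_cyl hx)
  have hf0' := CFData.mem_F_iff.1 (CFData.mem_F_of_mem_cyl hT)
  rw [CFData.mem_F_iff] at hf
  obtain ⟨c, hc, hxc⟩ := CFData.exists_mem_cyl_add hx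
  obtain ⟨c', hc', hxc'⟩ := CFData.exists_mem_cyl_add hT
  have hb := P.add_two_mul_h_le hn hc
  have hp := P.h_pos n
  change _ ∧ f < P.h n at hf0
  change _ ∧ f' < P.h n at hf0'
  change ¬ (_ ∧ f + 1 < P.h n) at hf
  have hmem : f + c + 1 ∈ P.toCFData.F (n + 1) := by
    rw [CFData.mem_F_iff]
    change 0 ≤ f + c + 1 ∧ f + c + 1 < P.h (n + 1)
    omega
  have he := CFData.cyl_unique hxc' (CFData.T_mem_cyl hxc hmem)
  have hlt : c < c' := by omega
  have := P.C_sep hn hc hc' hlt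
  omega

theorem frequently_label (l : CellLabel v) (N : ℕ) : ∃ n, N ≤ n ∧ P.label (n + 1) = l := by
  obtain ⟨m, hm, hlt⟩ := (P.label_infinite l).exists_gt (N + 1)
  exact ⟨m - 1, by omega, by rw [Nat.sub_add_cancel hm.1]; exact hm.2⟩

variable [AddCommGroup K]

/-- A part of `[f + δ]_n` that `T^{2h_n}` maps into `[f]_n`, and on which the skew product adds a
known constant, provided that the pairs `c`, `c - 2h_n - δ` of elements of `C_{n+1}` with a
prescribed increment of `α_{n+1}` are sufficiently many. -/
theorem exists_returning_set (α : ℕ → ℤ → K) {n : ℕ} {δ : ℕ} {β : K} {κ : ENNReal}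
    (hS : ∃ S ⊆ P.C (n + 1), (∀ c ∈ S, c - 2 * P.h n - δ ∈ P.C (n + 1) ∧
      α (n + 1) c = α (n + 1) (c - 2 * P.h n - δ) + β) ∧ κ * (P.C (n + 1)).card ≤ S.card)
    {f : ℤ} (hf : f ∈ P.toCFData.F n) (hfδ : f + δ ∈ P.toCFData.F n) :
    ∃ G : Set P.toCFData.X, MeasurableSet G ∧ G ⊆ P.toCFData.Cyl n (f + δ) ∧
      κ * P.toCFData.w n ≤ P.toCFData.μ G ∧
      ∀ x ∈ G, P.toCFData.T^[2 * P.h n] x ∈ P.toCFData.Cyl n f ∧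
        ∀ g, (P.toCFData.skew α)^[2 * P.h n] (x, g) = (P.toCFData.T^[2 * P.h n] x,
          P.toCFData.height α n f - P.toCFData.height α n (f + δ) + β + g) := by
  set D := P.toCFData with hD
  obtain ⟨S, hSC, hS, hcard⟩ := hS
  have hC : D.C (n + 1) = P.C (n + 1) := rfl
  have hmem : ∀ c ∈ S, f + c - 2 * P.h n ∈ D.F (n + 1) := by
    intro c hc
    have := D.add_mem n _ hfδ _ (hC ▸ (hS c hc).1)
    rwa [show f + δ + (c - 2 * P.h n - δ) = f + c - 2 * P.h n by ring] at this
  refine ⟨⋃ c ∈ S, D.Cyl (n + 1) (f + c - 2 * P.h n), ?_, ?_, ?_, ?_⟩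
  · exact S.measurableSet_biUnion fun c _ => CFData.measurableSet_cyl _ _
  · refine Set.iUnion₂_subset fun c hc => ?_
    rw [show f + c - 2 * P.h n = f + δ + (c - 2 * P.h n - δ) by ring]
    exact CFData.cyl_add_subset hfδ (hC ▸ (hS c hc).1)
  · rw [measure_biUnion_finset]
    · rw [Finset.sum_congr rfl fun c hc => CFData.mu_cyl (hmem c hc), Finset.sum_const,
        nsmul_eq_mul, CFData.w_succ n, ← mul_assoc]
      gcongr
      exact hcard
    · intro c _ c' _ hne
      refine Set.disjoint_left.2 fun x h1 h2 => hne ?_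
      have := CFData.cyl_unique h1 h2
      linarith
    · exact fun c _ => CFData.measurableSet_cyl _ _
  · intro x hx
    obtain ⟨c, hc, hx⟩ := Set.mem_iUnion₂.1 hx
    have hcC : c ∈ D.C (n + 1) := hSC hc
    have hsum : f + c - 2 * P.h n + ((2 * P.h n : ℕ) : ℤ) = f + c := by push_cast; ring
    obtain ⟨h1, h2⟩ := CFData.iterate_mem_cyl α (2 * P.h n) hx
      (by rw [hsum]; exact D.add_mem n f hf c hcC)
    rw [hsum] at h1 h2
    refine ⟨CFData.cyl_add_subset hf hcC h1, fun g => ?_⟩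
    rw [h2 g, show f + c - 2 * P.h n = f + δ + (c - 2 * P.h n - δ) by ring,
      CFData.height_add α hf hcC, CFData.height_add α hfδ (hC ▸ (hS c hc).1), (hS c hc).2]
    simp only [Prod.mk.injEq, true_and]
    abel

/-- If `n + 1` lies in the cell `M_{b,1}` and `n` is large, then the increments of `α_{n+1}` over
`2h_n` that are equal to `b`, and those over `2h_n + 1` that vanish, have a proportion bounded
below. -/
theorem exists_increments {α : ℕ → ℤ → K} (hα : P.Admissible α) {n : ℕ} (hn : 8 ≤ n)
    {b : Function.periodicPts v} (hl : P.label (n + 1) = .inr (b, 1)) {δ : ℕ} (hδ : δ ≤ 1) :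
    ∃ S ⊆ P.C (n + 1), (∀ c ∈ S, c - 2 * P.h n - δ ∈ P.C (n + 1) ∧
      α (n + 1) c = α (n + 1) (c - 2 * P.h n - δ) + if δ = 0 then (b : K) else 0) ∧
      (4 * per v b : ENNReal)⁻¹ * (P.C (n + 1)).card ≤ S.card := by
  have hm : (1 : ℝ) ≤ per v b := by exact_mod_cast per_pos v b
  have hn' : (8 : ℝ) ≤ n := by exact_mod_cast hn
  have hC : (0 : ℝ) < (P.C (n + 1)).card := by
    exact_mod_cast Finset.card_pos.2 ⟨0, P.zero_mem_C (n + 1)⟩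
  have key : ∀ S : Finset ℤ, 1 / (4 * per v b : ℝ) ≤ (S.card : ℝ) / (P.C (n + 1)).card →
      (4 * per v b : ENNReal)⁻¹ * (P.C (n + 1)).card ≤ S.card := by
    intro S hS
    have hnat : (P.C (n + 1)).card ≤ 4 * per v b * S.card := by
      rw [div_le_div_iff₀ (by positivity) hC] at hS
      have : ((P.C (n + 1)).card : ℝ) ≤ 4 * per v b * S.card := by linarith
      exact_mod_cast this
    have h0 : (4 * per v b : ENNReal) ≠ 0 := by
      have := per_pos v b
      simp only [ne_eq, mul_eq_zero, not_or]
      exact ⟨by norm_num, by exact_mod_cast this.ne'⟩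
    have htop : (4 * per v b : ENNReal) ≠ ⊤ :=
      ENNReal.mul_ne_top (by norm_num) (ENNReal.natCast_ne_top _)
    calc (4 * per v b : ENNReal)⁻¹ * (P.C (n + 1)).card
        ≤ (4 * per v b : ENNReal)⁻¹ * (4 * per v b * S.card) := by
          gcongr; exact_mod_cast hnat
      _ = S.card := by rw [← mul_assoc, ENNReal.inv_mul_cancel h0 htop, one_mul]
  rcases Nat.le_one_iff_eq_zero_or_eq_one.1 hδ with rfl | rfl
  · obtain ⟨S, hSC, hS, hc⟩ := hα.incrM n (by omega) b 1 hl 0 (per_pos v b)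
    refine ⟨S, hSC, fun c hc => ?_, key S ?_⟩
    · simpa using hS c hc
    · have h1 := (abs_lt.1 hc).1
      have h2 : 2 / (n * per v b : ℝ) ≤ 1 / (4 * per v b) := by
        rw [div_le_div_iff₀ (by positivity) (by positivity)]
        nlinarith
      have h3 : 1 / (((1 : ℕ+) + 1) * per v b : ℝ) = 2 * (1 / (4 * per v b)) := by
        push_cast
        field_simp
        norm_num
      rw [h3] at h1
      linarith
  · obtain ⟨S, hSC, hS, hc⟩ := hα.constM n (by omega) b 1 hl
    refine ⟨S, hSC, fun c hc => ?_, key S ?_⟩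
    · simpa using hS c hc
    · have h1 := (abs_lt.1 hc).1
      have h2 : 2 / (n : ℝ) ≤ 1 / 4 := by
        rw [div_le_div_iff₀ (by positivity) (by positivity)]
        linarith
      have h3 : 1 / (4 * per v b : ℝ) ≤ 1 / 4 := by
        rw [div_le_div_iff₀ (by positivity) (by positivity)]
        linarith
      have h4 : ((1 : ℕ+) : ℝ) / ((1 : ℕ+) + 1) = 1 / 2 := by norm_num
      rw [h4] at h1
      linarith

end SpecialChoice

namespace CFData

variable {D : CFData} {K : Type*} {p : ℕ}

/-! ### Boxes and level sets in `X^p × X × K` -/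

/-- The box `[a_1]_n × ⋯ × [a_p]_n × [a_{p+1}]_n × U` in `X^p × X × K`. -/
def Box (D : CFData) (n : ℕ) (a : (Fin p → ℤ) × ℤ) (U : Set K) : Set ((Fin p → D.X) × (D.X × K)) :=
  (Set.univ.pi fun i => D.Cyl n (a.1 i)) ×ˢ (D.Cyl n a.2 ×ˢ U)

theorem mem_box {n : ℕ} {a : (Fin p → ℤ) × ℤ} {U : Set K} {y : (Fin p → D.X) × (D.X × K)} :
    y ∈ D.Box n a U ↔ (∀ i, y.1 i ∈ D.Cyl n (a.1 i)) ∧ y.2.1 ∈ D.Cyl n a.2 ∧ y.2.2 ∈ U := by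
  simp [Box, Set.mem_prod, Set.mem_pi]

theorem box_mono {n : ℕ} {a : (Fin p → ℤ) × ℤ} {U V : Set K} (h : U ⊆ V) :
    D.Box n a U ⊆ D.Box n a V := fun _ hy => by
  rw [mem_box] at hy ⊢; exact ⟨hy.1, hy.2.1, h hy.2.2⟩

theorem box_unique {n : ℕ} {a a' : (Fin p → ℤ) × ℤ} {U U' : Set K}
    {y : (Fin p → D.X) × (D.X × K)} (h : y ∈ D.Box n a U) (h' : y ∈ D.Box n a' U') : a = a' := by
  rw [mem_box] at h h'
  exact Prod.ext (funext fun i => cyl_unique (h.1 i) (h'.1 i)) (cyl_unique h.2.1 h'.2.1)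

/-- The addresses `a` with all entries in `F_n`. -/
def Valid (D : CFData) (n : ℕ) (a : (Fin p → ℤ) × ℤ) : Prop := (∀ i, a.1 i ∈ D.F n) ∧ a.2 ∈ D.F n

theorem valid_of_mem_box {n : ℕ} {a : (Fin p → ℤ) × ℤ} {U : Set K}
    {y : (Fin p → D.X) × (D.X × K)} (h : y ∈ D.Box n a U) : D.Valid n a := by
  rw [mem_box] at h
  exact ⟨fun i => mem_F_of_mem_cyl (h.1 i), mem_F_of_mem_cyl h.2.1⟩

theorem exists_box_of_le {n m : ℕ} (h : n ≤ m) {a : (Fin p → ℤ) × ℤ} {U : Set K}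
    {y : (Fin p → D.X) × (D.X × K)} (hy : y ∈ D.Box n a U) :
    ∃ a', y ∈ D.Box m a' U ∧ ((∀ i, D.Cyl m (a'.1 i) ⊆ D.Cyl n (a.1 i)) ∧
      D.Cyl m a'.2 ⊆ D.Cyl n a.2) := by
  rw [mem_box] at hy
  choose f hf using fun i => exists_mem_cyl_of_le h (hy.1 i)
  obtain ⟨g, hg⟩ := exists_mem_cyl_of_le h hy.2.1
  exact ⟨(f, g), mem_box.2 ⟨hf, hg, hy.2.2⟩, fun i => cyl_subset_cyl h (hy.1 i) (hf i),
    cyl_subset_cyl h hy.2.1 hg⟩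

theorem exists_mem_box (y : (Fin p → D.X) × (D.X × K)) :
    ∃ n a, y ∈ D.Box n a Set.univ := by
  choose N f hf using fun i => exists_mem_cyl (y.1 i)
  obtain ⟨M, g, hg⟩ := exists_mem_cyl y.2.1
  set m := max M (Finset.univ.sup N)
  choose f' hf' using fun i => exists_mem_cyl_of_le (m := m)
    ((Finset.le_sup (Finset.mem_univ i)).trans (le_max_right _ _)) (hf i)
  obtain ⟨g', hg'⟩ := exists_mem_cyl_of_le (m := m) (le_max_left _ _) hg
  exact ⟨m, (f', g'), mem_box.2 ⟨hf', hg', trivial⟩⟩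

/-- The set `X_n^p × X_n × K`. -/
def full (D : CFData) (p : ℕ) (K : Type*) (n : ℕ) : Set ((Fin p → D.X) × (D.X × K)) :=
  ⋃ a, D.Box n a Set.univ

theorem full_mono {n m : ℕ} (h : n ≤ m) : D.full p K n ⊆ D.full p K m := by
  refine Set.iUnion_subset fun a y hy => ?_
  obtain ⟨a', ha', -⟩ := exists_box_of_le h hy
  exact Set.mem_iUnion.2 ⟨a', ha'⟩

theorem exists_mem_full (y : (Fin p → D.X) × (D.X × K)) : ∃ n, y ∈ D.full p K n := by
  obtain ⟨n, a, h⟩ := exists_mem_box y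
  exact ⟨n, Set.mem_iUnion.2 ⟨a, h⟩⟩

variable [MeasurableSpace K]

theorem measurableSet_box (n : ℕ) (a : (Fin p → ℤ) × ℤ) {U : Set K} (hU : MeasurableSet U) :
    MeasurableSet (D.Box n a U) :=
  (MeasurableSet.univ_pi fun _ => measurableSet_cyl _ _).prod ((measurableSet_cyl _ _).prod hU)

/-- The measurable subsets of `X_n^p × X_n × K` which depend only on the entries `f_n` of the points
of `X_n`, and on the coordinate in `K`. -/
def IsLevel (n : ℕ) (A : Set ((Fin p → D.X) × (D.X × K))) : Prop :=
  ∃ U : (Fin p → ℤ) × ℤ → Set K, (∀ a, MeasurableSet (U a)) ∧ A = ⋃ a, D.Box n a (U a)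

theorem IsLevel.mono {n m : ℕ} (h : n ≤ m) {A : Set ((Fin p → D.X) × (D.X × K))}
    (hA : IsLevel n A) : IsLevel m A := by
  obtain ⟨U, hU, rfl⟩ := hA
  refine ⟨fun a' => ⋃ (a) (_ : (∀ i, D.Cyl m (a'.1 i) ⊆ D.Cyl n (a.1 i)) ∧
    D.Cyl m a'.2 ⊆ D.Cyl n a.2), U a, fun a' => MeasurableSet.iUnion fun a =>
      MeasurableSet.iUnion fun _ => hU a, Set.Subset.antisymm ?_ ?_⟩
  · refine Set.iUnion_subset fun a y hy => ?_
    obtain ⟨a', h1, h2⟩ := exists_box_of_le h hy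
    exact Set.mem_iUnion.2 ⟨a', box_mono (Set.subset_iUnion₂_of_subset a h2 subset_rfl) h1⟩
  · refine Set.iUnion_subset fun a' y hy => ?_
    rw [mem_box] at hy
    obtain ⟨h1, h2, h3⟩ := hy
    obtain ⟨a, ha, h4⟩ := Set.mem_iUnion₂.1 h3
    exact Set.mem_iUnion.2 ⟨a, mem_box.2 ⟨fun i => ha.1 i (h1 i), ha.2 h2, h4⟩⟩

theorem isLevel_box (n : ℕ) (a : (Fin p → ℤ) × ℤ) {U : Set K} (hU : MeasurableSet U) :
    IsLevel n (D.Box n a U) := by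
  classical
  refine ⟨fun a' => if a' = a then U else ∅, fun a' => ?_, Set.Subset.antisymm ?_ ?_⟩
  · beta_reduce
    split_ifs
    exacts [hU, MeasurableSet.empty]
  · exact Set.subset_iUnion_of_subset a (by simp)
  · refine Set.iUnion_subset fun a' y hy => ?_
    rw [mem_box] at hy ⊢
    by_cases h : a' = a
    · subst h; simpa using hy
    · simp [h] at hy

theorem IsLevel.measurableSet {n : ℕ} {A : Set ((Fin p → D.X) × (D.X × K))} (hA : IsLevel n A) :
    MeasurableSet A := by
  obtain ⟨U, hU, rfl⟩ := hA
  exact MeasurableSet.iUnion fun a => measurableSet_box n a (hU a)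

theorem IsLevel.union {n : ℕ} {A B : Set ((Fin p → D.X) × (D.X × K))} (hA : IsLevel n A)
    (hB : IsLevel n B) : IsLevel n (A ∪ B) := by
  obtain ⟨U, hU, rfl⟩ := hA
  obtain ⟨V, hV, rfl⟩ := hB
  refine ⟨fun a => U a ∪ V a, fun a => (hU a).union (hV a), ?_⟩
  rw [← Set.iUnion_union_distrib]
  refine Set.iUnion_congr fun a => ?_
  ext y
  simp only [Set.mem_union, mem_box]
  tauto

theorem IsLevel.diff {n : ℕ} {A B : Set ((Fin p → D.X) × (D.X × K))} (hA : IsLevel n A)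
    (hB : IsLevel n B) : IsLevel n (A \ B) := by
  obtain ⟨U, hU, rfl⟩ := hA
  obtain ⟨V, hV, rfl⟩ := hB
  refine ⟨fun a => U a \ V a, fun a => (hU a).diff (hV a), ?_⟩
  ext y
  simp only [Set.mem_sdiff, Set.mem_iUnion, not_exists]
  constructor
  · rintro ⟨⟨a, ha⟩, h⟩
    refine ⟨a, ?_⟩
    have := h a
    rw [mem_box] at ha this ⊢
    exact ⟨ha.1, ha.2.1, ha.2.2, fun hV => this ⟨ha.1, ha.2.1, hV⟩⟩
  · rintro ⟨a, ha⟩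
    refine ⟨⟨a, box_mono Set.sdiff_subset ha⟩, fun a' ha' => ?_⟩
    rw [box_unique ha' ha] at ha'
    exact (mem_box.1 ha).2.2.2 (mem_box.1 ha').2.2

/-- The ring of all level sets. -/
def levelSets (D : CFData) (p : ℕ) (K : Type*) [MeasurableSpace K] :
    Set (Set ((Fin p → D.X) × (D.X × K))) := {A | ∃ n, IsLevel n A}

theorem isSetRing_levelSets : IsSetRing (D.levelSets p K) where
  empty_mem := ⟨0, fun _ => ∅, fun _ => MeasurableSet.empty, by simp [Box]⟩
  union_mem := by
    rintro A B ⟨n, hA⟩ ⟨m, hB⟩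
    exact ⟨max n m, (hA.mono (le_max_left _ _)).union (hB.mono (le_max_right _ _))⟩
  sdiff_mem := by
    rintro A B ⟨n, hA⟩ ⟨m, hB⟩
    exact ⟨max n m, (hA.mono (le_max_left _ _)).diff (hB.mono (le_max_right _ _))⟩

theorem measurableSpace_eq_levelSets :
    (inferInstance : MeasurableSpace ((Fin p → D.X) × (D.X × K))) =
      MeasurableSpace.generateFrom (D.levelSets p K) := by
  refine le_antisymm ?_ (MeasurableSpace.generateFrom_le ?_)
  · let m' := MeasurableSpace.generateFrom (D.levelSets p K)
    have hbox : ∀ n (a : (Fin p → ℤ) × ℤ) {U : Set K}, MeasurableSet U →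
        MeasurableSet[MeasurableSpace.generateFrom (D.levelSets p K)] (D.Box n a U) :=
      fun n a U hU => MeasurableSpace.measurableSet_generateFrom ⟨n, isLevel_box n a hU⟩
    -- a coordinate with values in `X` is measurable
    have hX : ∀ φ : (Fin p → D.X) × (D.X × K) → D.X, (∀ m (a : (Fin p → ℤ) × ℤ), ∃ f : ℤ,
        ∀ y ∈ D.Box m a (Set.univ : Set K), φ y ∈ D.Cyl m f) →
        MeasurableSpace.comap φ inferInstance ≤
          MeasurableSpace.generateFrom (D.levelSets p K) := by
      intro φ hφ
      rw [measurableSpace_eq, MeasurableSpace.comap_generateFrom]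
      refine MeasurableSpace.generateFrom_le ?_
      rintro _ ⟨_, ⟨⟨n, f⟩, rfl⟩, rfl⟩
      have : φ ⁻¹' D.Cyl n f = ⋃ (m : ℕ) (a : (Fin p → ℤ) × ℤ)
          (_ : D.Box m a (Set.univ : Set K) ⊆ φ ⁻¹' D.Cyl n f), D.Box m a Set.univ := by
        refine Set.Subset.antisymm (fun y hy => ?_) (Set.iUnion_subset fun m =>
          Set.iUnion_subset fun a => Set.iUnion_subset fun h => h)
        obtain ⟨m₀, a₀, h₀⟩ := exists_mem_box y
        obtain ⟨a, ha, -⟩ := exists_box_of_le (le_max_right n m₀) h₀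
        obtain ⟨g, hg⟩ := hφ (max n m₀) a
        exact Set.mem_iUnion.2 ⟨_, Set.mem_iUnion.2 ⟨a, Set.mem_iUnion.2 ⟨fun y' hy' =>
          cyl_subset_cyl (le_max_left n m₀) hy (hg y ha) (hg y' hy'), ha⟩⟩⟩
      change MeasurableSet[MeasurableSpace.generateFrom (D.levelSets p K)] (φ ⁻¹' D.Cyl n f)
      rw [this]
      exact @MeasurableSet.iUnion _ _ m' _ _ fun m => @MeasurableSet.iUnion _ _ m' _ _ fun a =>
        @MeasurableSet.iUnion _ _ m' _ _ fun _ => hbox m a MeasurableSet.univ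
    have hK : MeasurableSpace.comap (fun y : (Fin p → D.X) × (D.X × K) => y.2.2) inferInstance ≤
        MeasurableSpace.generateFrom (D.levelSets p K) := by
      rintro _ ⟨U, hU, rfl⟩
      have : (fun y : (Fin p → D.X) × (D.X × K) => y.2.2) ⁻¹' U =
          ⋃ (m : ℕ) (a : (Fin p → ℤ) × ℤ), D.Box m a U := by
        ext y
        simp only [Set.mem_preimage, Set.mem_iUnion]
        refine ⟨fun hy => ?_, fun ⟨m, a, hy⟩ => (mem_box.1 hy).2.2⟩
        obtain ⟨m, a, ha⟩ := exists_mem_box y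
        rw [mem_box] at ha
        exact ⟨m, a, mem_box.2 ⟨ha.1, ha.2.1, hy⟩⟩
      rw [this]
      exact @MeasurableSet.iUnion _ _ m' _ _ fun m => @MeasurableSet.iUnion _ _ m' _ _ fun a =>
        hbox m a hU
    refine sup_le ?_ ?_
    · change MeasurableSpace.comap Prod.fst
        (⨆ i : Fin p, MeasurableSpace.comap (fun x : Fin p → D.X => x i) _) ≤ _
      rw [MeasurableSpace.comap_iSup]
      refine iSup_le fun i => ?_
      rw [MeasurableSpace.comap_comp]
      exact hX _ fun m a => ⟨a.1 i, fun y hy => (mem_box.1 hy).1 i⟩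
    · change MeasurableSpace.comap Prod.snd (MeasurableSpace.comap Prod.fst _ ⊔
        MeasurableSpace.comap Prod.snd _) ≤ _
      rw [MeasurableSpace.comap_sup, MeasurableSpace.comap_comp, MeasurableSpace.comap_comp]
      exact sup_le (hX _ fun m a => ⟨a.2, fun y hy => (mem_box.1 hy).2.1⟩) hK
  · rintro A ⟨n, hA⟩
    exact hA.measurableSet

theorem isLevel_full (n : ℕ) : IsLevel n (D.full p K n) := ⟨fun _ => Set.univ, by simp, rfl⟩

/-- The measure `μ^p × μ × λ_K`. -/
def prodMeasure (D : CFData) (p : ℕ) (lam : Measure K) : Measure ((Fin p → D.X) × (D.X × K)) :=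
  (Measure.pi fun _ : Fin p => D.μ).prod (D.μ.prod lam)

variable (lam : Measure K) [IsFiniteMeasure lam]

theorem prodMeasure_prod (G : Fin p → Set D.X) (H : Set D.X) (U : Set K) :
    D.prodMeasure p lam ((Set.univ.pi G) ×ˢ (H ×ˢ U)) = (∏ i, D.μ (G i)) * (D.μ H * lam U) := by
  rw [prodMeasure, Measure.prod_prod, Measure.prod_prod, Measure.pi_pi]

theorem prodMeasure_box {n : ℕ} {a : (Fin p → ℤ) × ℤ} (ha : D.Valid n a) (U : Set K) :
    D.prodMeasure p lam (D.Box n a U) = D.w n ^ p * (D.w n * lam U) := by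
  rw [Box, prodMeasure_prod, mu_cyl ha.2, Finset.prod_congr rfl fun i _ => mu_cyl (ha.1 i)]
  simp

theorem mu_range_lt_top (n : ℕ) : D.μ (Set.range (D.ι n)) < ⊤ := by
  have : Set.range (D.ι n) = ⋃ f ∈ D.F n, D.Cyl n f := by
    ext x
    rw [mem_range_ι, Set.mem_iUnion₂]
    exact ⟨fun ⟨f, hf⟩ => ⟨f, mem_F_of_mem_cyl hf, hf⟩, fun ⟨f, _, hf⟩ => ⟨f, hf⟩⟩
  rw [this]
  exact measure_biUnion_lt_top (Finset.finite_toSet _) fun f _ => mu_cyl_lt_top _ _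

theorem prodMeasure_full_lt_top (n : ℕ) : D.prodMeasure p lam (D.full p K n) < ⊤ := by
  have hsub : D.full p K n ⊆
      (Set.univ.pi fun _ : Fin p => Set.range (D.ι n)) ×ˢ (Set.range (D.ι n) ×ˢ Set.univ) := by
    refine Set.iUnion_subset fun a y hy => ?_
    rw [mem_box] at hy
    exact ⟨fun i _ => mem_range_ι.2 ⟨_, hy.1 i⟩, mem_range_ι.2 ⟨_, hy.2.1⟩, trivial⟩
  refine (measure_mono hsub).trans_lt ?_
  rw [prodMeasure_prod]
  exact ENNReal.mul_lt_top (ENNReal.prod_lt_top fun _ _ => mu_range_lt_top n)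
    (ENNReal.mul_lt_top (mu_range_lt_top n) (measure_lt_top _ _))

/-- Within `X_N^p × X_N × K`, measurable sets are approximated by level sets. -/
theorem exists_level_approx {A : Set ((Fin p → D.X) × (D.X × K))} (hA : MeasurableSet A) (N : ℕ)
    {ε : ENNReal} (hε : 0 < ε) : ∃ m, ∃ t : Set ((Fin p → D.X) × (D.X × K)), IsLevel m t ∧
      D.prodMeasure p lam ((symmDiff t A) ∩ D.full p K N) < ε := by
  have : IsFiniteMeasure ((D.prodMeasure p lam).restrict (D.full p K N)) :=
    ⟨by rw [Measure.restrict_apply_univ]; exact prodMeasure_full_lt_top lam N⟩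
  have hcover : ⋃₀ (Set.range fun n => D.full p K n) = Set.univ := by
    refine Set.eq_univ_of_forall fun y => ?_
    obtain ⟨n, hn⟩ := exists_mem_full y
    exact ⟨_, ⟨n, rfl⟩, hn⟩
  obtain ⟨t, ⟨m, ht⟩, hlt⟩ := exists_measure_symmDiff_lt_of_generateFrom_isSetRing
    (μ := (D.prodMeasure p lam).restrict (D.full p K N)) isSetRing_levelSets
    ⟨Set.range fun n => D.full p K n, Set.countable_range _,
      by rintro _ ⟨n, rfl⟩; exact ⟨n, isLevel_full n⟩,
      by rw [hcover, Set.compl_univ, measure_empty]⟩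
    measurableSpace_eq_levelSets hA hε
  refine ⟨m, t, ht, ?_⟩
  rwa [Measure.restrict_apply (ht.measurableSet.symmDiff hA)] at hlt

/-- Measures that agree on the level sets, and are finite on them, are equal. -/
theorem ext_of_levelSets {ρ σ : Measure ((Fin p → D.X) × (D.X × K))}
    (hρ : ∀ n, ρ (D.full p K n) ≠ ⊤) (h : ∀ n A, IsLevel n A → ρ A = σ A) : ρ = σ := by
  refine Measure.ext_of_generateFrom_of_iUnion (D.levelSets p K) (fun n => D.full p K n)
    measurableSpace_eq_levelSets isSetRing_levelSets.isSetSemiring.isPiSystem ?_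
    (fun n => ⟨n, isLevel_full n⟩) hρ fun s ⟨n, hs⟩ => h n s hs
  exact Set.eq_univ_of_forall fun y => Set.mem_iUnion.2 (exists_mem_full y)

end CFData

namespace CFData

variable {D : CFData} {K : Type*} [AddCommGroup K] {p : ℕ}

/-! ### The maps approximated by high powers of the product -/

/-- The transformation `T^{×p} × T_α`. -/
def prodMap (D : CFData) (p : ℕ) (α : ℕ → ℤ → K) :
    (Fin p → D.X) × (D.X × K) → (Fin p → D.X) × (D.X × K) :=
  Prod.map (fun (x : Fin p → D.X) i => D.T (x i)) (D.skew α)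

/-- The map `T^{δ_1} × ⋯ × T^{δ_p} × T_α^{δ_{p+1}}` followed by the translation by `-β` of `K`. -/
def delayMap (D : CFData) (α : ℕ → ℤ → K) (δ : (Fin p → ℕ) × ℕ) (β : K)
    (y : (Fin p → D.X) × (D.X × K)) : (Fin p → D.X) × (D.X × K) :=
  (fun i => D.T^[δ.1 i] (y.1 i),
    (((D.skew α)^[δ.2] y.2).1, ((D.skew α)^[δ.2] y.2).2 + -β))

/-- The address `a + δ`. -/
def addDelay (a : (Fin p → ℤ) × ℤ) (δ : (Fin p → ℕ) × ℕ) : (Fin p → ℤ) × ℤ :=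
  (fun i => a.1 i + δ.1 i, a.2 + δ.2)

/-- The amount by which `delayMap` translates `K` above the box with address `a` at level `n`. -/
def delayShift (D : CFData) (α : ℕ → ℤ → K) (δ : (Fin p → ℕ) × ℕ) (β : K) (n : ℕ)
    (a : (Fin p → ℤ) × ℤ) : K :=
  D.height α n (a.2 + δ.2) - D.height α n a.2 + -β

theorem iterate_prodMap (α : ℕ → ℤ → K) (k : ℕ) (y : (Fin p → D.X) × (D.X × K)) :
    (D.prodMap p α)^[k] y = (fun i => D.T^[k] (y.1 i), (D.skew α)^[k] y.2) := by
  induction k with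
  | zero => rfl
  | succ k ih =>
    rw [Function.iterate_succ_apply', ih]
    simp only [prodMap, Prod.map, Function.iterate_succ_apply']

theorem fst_iterate_skew (α : ℕ → ℤ → K) (k : ℕ) (q : D.X × K) :
    ((D.skew α)^[k] q).1 = D.T^[k] q.1 := by
  induction k with
  | zero => rfl
  | succ k ih => rw [Function.iterate_succ_apply', Function.iterate_succ_apply', skew, ih]

/-- On a box, `delayMap` acts as a translation. -/
theorem delayMap_snd_snd (α : ℕ → ℤ → K) {δ : (Fin p → ℕ) × ℕ} (β : K) {n : ℕ}
    {a : (Fin p → ℤ) × ℤ} {U : Set K} {y : (Fin p → D.X) × (D.X × K)} (hy : y ∈ D.Box n a U)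
    (ha : a.2 + δ.2 ∈ D.F n) :
    (D.delayMap α δ β y).2.2 = y.2.2 + D.delayShift α δ β n a := by
  obtain ⟨x, x', g⟩ := y
  rw [mem_box] at hy
  have := (iterate_mem_cyl α δ.2 hy.2.1 ha).2 g
  simp only [delayMap, this, delayShift]
  abel

theorem iterate_preimage_cyl (hD : D.IsTotal) {n d : ℕ} (hd : d ≤ 1) {f : ℤ} (hf : 0 ≤ f)
    (hfd : f + d ∈ D.F n) {x : D.X} : D.T^[d] x ∈ D.Cyl n (f + d) ↔ x ∈ D.Cyl n f := by
  rcases Nat.le_one_iff_eq_zero_or_eq_one.1 hd with rfl | rfl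
  · simp
  · have := preimage_T_cyl hD hf (by simpa using hfd)
    simp only [Function.iterate_one, Nat.cast_one]
    rw [← this]; rfl

theorem delayMap_preimage_box (hD : D.IsTotal) (α : ℕ → ℤ → K) {δ : (Fin p → ℕ) × ℕ}
    (hδ : (∀ i, δ.1 i ≤ 1) ∧ δ.2 ≤ 1) (β : K) {n : ℕ} {a : (Fin p → ℤ) × ℤ} (ha : D.Valid n a)
    (haδ : D.Valid n (addDelay a δ)) (U : Set K) :
    D.delayMap α δ β ⁻¹' D.Box n (addDelay a δ) U =
      D.Box n a ((· + D.delayShift α δ β n a) ⁻¹' U) := by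
  ext y
  have h1 : ∀ i, D.T^[δ.1 i] (y.1 i) ∈ D.Cyl n (a.1 i + δ.1 i) ↔ y.1 i ∈ D.Cyl n (a.1 i) :=
    fun i => iterate_preimage_cyl hD (hδ.1 i) (mem_F_iff.1 (ha.1 i)).1 (haδ.1 i)
  have h2 : D.T^[δ.2] y.2.1 ∈ D.Cyl n (a.2 + δ.2) ↔ y.2.1 ∈ D.Cyl n a.2 :=
    iterate_preimage_cyl hD hδ.2 (mem_F_iff.1 ha.2).1 haδ.2
  rw [Set.mem_preimage, mem_box, mem_box]
  refine and_congr (forall_congr' h1) ?_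
  simp only [delayMap, fst_iterate_skew, addDelay, h2]
  refine and_congr_right fun h => ?_
  have := (iterate_mem_cyl α δ.2 h haδ.2).2 y.2.2
  change ((D.skew α)^[δ.2] (y.2.1, y.2.2)).2 + -β ∈ U ↔ y.2.2 + D.delayShift α δ β n a ∈ U
  rw [this, delayShift, show D.height α n (a.2 + δ.2) - D.height α n a.2 + y.2.2 + -β =
    y.2.2 + (D.height α n (a.2 + δ.2) - D.height α n a.2 + -β) by abel]

variable [MeasurableSpace K] [MeasurableAdd₂ K] (lam : Measure K) [IsFiniteMeasure lam]
  [lam.IsAddLeftInvariant]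

theorem measurePreserving_prodMap (hD : D.IsTotal) (α : ℕ → ℤ → K) :
    MeasurePreserving (D.prodMap p α) (D.prodMeasure p lam) (D.prodMeasure p lam) :=
  (measurePreserving_pi (fun _ : Fin p => D.μ) (fun _ => D.μ) fun _ =>
    measurePreserving_T hD).prod (measurePreserving_skew lam hD α)

theorem measurePreserving_delayMap (hD : D.IsTotal) (α : ℕ → ℤ → K) (δ : (Fin p → ℕ) × ℕ)
    (β : K) :
    MeasurePreserving (D.delayMap α δ β) (D.prodMeasure p lam) (D.prodMeasure p lam) := by
  have h1 : MeasurePreserving (fun q : D.X × K => (q.1, q.2 + -β)) (D.μ.prod lam) (D.μ.prod lam) :=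
    (MeasurePreserving.id D.μ).prod (measurePreserving_add_right lam (-β))
  exact (measurePreserving_pi (fun _ : Fin p => D.μ) (fun _ => D.μ) fun i =>
    (measurePreserving_T hD).iterate (δ.1 i)).prod
      (h1.comp ((measurePreserving_skew lam hD α).iterate δ.2))

end CFData

namespace SpecialChoice

variable {K : Type*} {v : K → K} (P : SpecialChoice v) {p : ℕ}

theorem eq_add_of_iterate_mem {n d : ℕ} (hn : 1 ≤ n) (hd : d ≤ 1) {f f' : ℤ} {x : P.toCFData.X}
    (hx : x ∈ P.toCFData.Cyl n f) (hT : P.toCFData.T^[d] x ∈ P.toCFData.Cyl n f') :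
    f' = f + d := by
  rcases Nat.le_one_iff_eq_zero_or_eq_one.1 hd with rfl | rfl
  · simpa using CFData.cyl_unique hT hx
  · simpa using P.eq_add_one_of_T_mem hn hx hT

open CFData

variable [AddCommGroup K] [MeasurableSpace K] [MeasurableAdd₂ K] (lam : Measure K)
  [IsFiniteMeasure lam] [lam.IsAddLeftInvariant]

/-- A part of the box with address `a + δ` that returns to the box with address `a` after time
`2h_n`, by the inverse of `delayMap`. -/
theorem exists_returning_box {α : ℕ → ℤ → K} (hα : P.Admissible α) {n : ℕ} (hn : 8 ≤ n)
    {b : Function.periodicPts v} (hl : P.label (n + 1) = .inr (b, 1)) {δ : (Fin p → ℕ) × ℕ}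
    (hδ : (∀ i, δ.1 i ≤ 1) ∧ δ.2 ≤ 1) {a : (Fin p → ℤ) × ℤ} (ha : P.toCFData.Valid n a)
    (haδ : P.toCFData.Valid n (addDelay a δ)) {Z : Set K} (hZ : MeasurableSet Z) :
    ∃ G, MeasurableSet G ∧
      ((4 * per v b : ENNReal)⁻¹) ^ (p + 1) *
        P.toCFData.prodMeasure p lam (P.toCFData.Box n a Z) ≤ P.toCFData.prodMeasure p lam G ∧
      ∀ y ∈ G, (P.toCFData.prodMap p α)^[2 * P.h n] y ∈ P.toCFData.Box n a Z ∧
        y ∈ P.toCFData.Box n (addDelay a δ)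
          ((· + P.toCFData.delayShift α δ (if δ.2 = 0 then (b : K) else 0) n a) '' Z) := by
  set κ : ENNReal := (4 * per v b : ENNReal)⁻¹
  set β : K := if δ.2 = 0 then (b : K) else 0 with hβ
  set t := P.toCFData.delayShift α δ β n a with ht
  choose G hG hGsub hGμ hGT using fun i =>
    P.exists_returning_set α (P.exists_increments hα hn hl (hδ.1 i)) (ha.1 i) (haδ.1 i)
  obtain ⟨H, hH, hHsub, hHμ, hHT⟩ :=
    P.exists_returning_set α (P.exists_increments hα hn hl hδ.2) ha.2 haδ.2
  refine ⟨(Set.univ.pi G) ×ˢ (H ×ˢ ((· + -t) ⁻¹' Z)), ?_, ?_, ?_⟩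
  · exact (MeasurableSet.univ_pi hG).prod (hH.prod ((measurable_add_const _) hZ))
  · rw [prodMeasure_prod, prodMeasure_box lam ha, measure_preimage_add_right]
    calc κ ^ (p + 1) * (P.toCFData.w n ^ p * (P.toCFData.w n * lam Z))
        = (∏ _i : Fin p, κ * P.toCFData.w n) * (κ * P.toCFData.w n * lam Z) := by
          rw [Finset.prod_const, Finset.card_univ, Fintype.card_fin, mul_pow]; ring
      _ ≤ _ := by
          gcongr with i
          exact hGμ i
  · rintro ⟨x, x', g⟩ ⟨hx, hx', hg⟩
    obtain ⟨h1, h2⟩ := hHT x' hx'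
    have hg' : g + -t ∈ Z := hg
    rw [iterate_prodMap, mem_box, mem_box]
    refine ⟨⟨fun i => (hGT i _ (hx i trivial)).1, ?_⟩, fun i => hGsub i (hx i trivial),
      hHsub hx', g + -t, hg', by simp⟩
    change ((P.toCFData.skew α)^[2 * P.h n] (x', g)).1 ∈ _ ∧
      ((P.toCFData.skew α)^[2 * P.h n] (x', g)).2 ∈ _
    rw [h2 g]
    refine ⟨h1, ?_⟩
    convert hg' using 1
    rw [ht, delayShift, ← hβ]
    abel_nf

/-- For level sets, recurrence at time `2h_n` dominates a multiple of the recurrence under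
`delayMap`. -/
theorem measure_inter_preimage_delayMap_le {α : ℕ → ℤ → K} (hα : P.Admissible α) {n : ℕ}
    (hn : 8 ≤ n) {b : Function.periodicPts v} (hl : P.label (n + 1) = .inr (b, 1))
    {δ : (Fin p → ℕ) × ℕ} (hδ : (∀ i, δ.1 i ≤ 1) ∧ δ.2 ≤ 1)
    {A B : Set ((Fin p → P.toCFData.X) × (P.toCFData.X × K))} (hA : IsLevel n A)
    (hB : IsLevel n B) :
    ((4 * per v b : ENNReal)⁻¹) ^ (p + 1) * P.toCFData.prodMeasure p lam
        (A ∩ P.toCFData.delayMap α δ (if δ.2 = 0 then (b : K) else 0) ⁻¹' B) ≤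
      P.toCFData.prodMeasure p lam ((P.toCFData.prodMap p α)^[2 * P.h n] ⁻¹' A ∩ B) := by
  classical
  set D := P.toCFData with hD
  set κ : ENNReal := (4 * per v b : ENNReal)⁻¹
  set β : K := if δ.2 = 0 then (b : K) else 0 with hβ
  have hBm := hB.measurableSet
  obtain ⟨U, hU, rfl⟩ := hA
  obtain ⟨V, hV, rfl⟩ := hB
  -- the part of `A` in the box with address `a` that `delayMap` maps into `B`
  let Z : (Fin p → ℤ) × ℤ → Set K := fun a => if D.Valid n a ∧ D.Valid n (addDelay a δ) then
    U a ∩ (· + D.delayShift α δ β n a) ⁻¹' V (addDelay a δ) else ∅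
  have hZ : ∀ a, MeasurableSet (Z a) := by
    intro a
    simp only [Z]
    split_ifs
    · exact (hU a).inter (measurable_add_const _ (hV _))
    · exact MeasurableSet.empty
  have hsub : (⋃ a, D.Box n a (U a)) ∩ D.delayMap α δ β ⁻¹' (⋃ a, D.Box n a (V a)) ⊆
      ⋃ a, D.Box n a (Z a) := by
    rintro y ⟨hy, hy'⟩
    obtain ⟨a, hya⟩ := Set.mem_iUnion.1 hy
    obtain ⟨a', hya'⟩ := Set.mem_iUnion.1 (Set.mem_preimage.1 hy')
    have hyb := mem_box.1 hya
    have hyb' := mem_box.1 hya'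
    have haa : a' = addDelay a δ := by
      refine Prod.ext (funext fun i => ?_) ?_
      · exact P.eq_add_of_iterate_mem (by omega) (hδ.1 i) (hyb.1 i) (hyb'.1 i)
      · refine P.eq_add_of_iterate_mem (by omega) hδ.2 hyb.2.1 ?_
        have := hyb'.2.1
        rwa [delayMap, fst_iterate_skew] at this
    subst haa
    have hv := valid_of_mem_box hya
    have hv' := valid_of_mem_box hya'
    refine Set.mem_iUnion.2 ⟨a, mem_box.2 ⟨hyb.1, hyb.2.1, ?_⟩⟩
    simp only [Z, hv, hv', and_self, if_true]
    refine ⟨hyb.2.2, ?_⟩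
    have := hyb'.2.2
    rwa [delayMap_snd_snd α β hya hv'.2] at this
  have hex : ∀ a, ∃ G, MeasurableSet G ∧
      κ ^ (p + 1) * D.prodMeasure p lam (D.Box n a (Z a)) ≤ D.prodMeasure p lam G ∧
      ∀ y ∈ G, (D.prodMap p α)^[2 * P.h n] y ∈ D.Box n a (Z a) ∧
        y ∈ D.Box n (addDelay a δ) ((· + D.delayShift α δ β n a) '' Z a) := by
    intro a
    by_cases hv : D.Valid n a ∧ D.Valid n (addDelay a δ)
    · exact P.exists_returning_box lam hα hn hl hδ hv.1 hv.2 (hZ a)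
    · refine ⟨∅, MeasurableSet.empty, ?_, fun y hy => hy.elim⟩
      simp [Z, hv, Box]
  choose G hG hGμ hGT using hex
  have haddinj : ∀ a a' : (Fin p → ℤ) × ℤ, addDelay a δ = addDelay a' δ → a = a' := by
    intro a a' h
    simp only [addDelay, Prod.mk.injEq, funext_iff, add_left_inj] at h
    exact Prod.ext (funext h.1) h.2
  have hdisj : Pairwise (Function.onFun Disjoint G) := fun a a' hne =>
    Set.disjoint_left.2 fun y h1 h2 =>
      hne (haddinj a a' (box_unique (hGT a y h1).2 (hGT a' y h2).2))
  calc κ ^ (p + 1) * D.prodMeasure p lam _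
      ≤ κ ^ (p + 1) * ∑' a, D.prodMeasure p lam (D.Box n a (Z a)) := by
        gcongr
        exact (measure_mono hsub).trans (measure_iUnion_le _)
    _ ≤ ∑' a, D.prodMeasure p lam (G a) := by
        rw [← ENNReal.tsum_mul_left]
        exact ENNReal.tsum_le_tsum hGμ
    _ = D.prodMeasure p lam (⋃ a, G a) := (measure_iUnion hdisj hG).symm
    _ ≤ _ := by
        refine measure_mono (Set.iUnion_subset fun a y hy => ?_)
        obtain ⟨h1, h2⟩ := hGT a y hy
        have hv : D.Valid n a ∧ D.Valid n (addDelay a δ) :=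
          ⟨valid_of_mem_box h1, valid_of_mem_box h2⟩
        have hZa : Z a = U a ∩ (· + D.delayShift α δ β n a) ⁻¹' V (addDelay a δ) := if_pos hv
        rw [hZa] at h1 h2
        refine ⟨Set.mem_iUnion.2 ⟨a, box_mono Set.inter_subset_left h1⟩,
          Set.mem_iUnion.2 ⟨addDelay a δ, box_mono ?_ h2⟩⟩
        rintro _ ⟨g, hg, rfl⟩
        exact hg.2

/-- An invariant set is almost invariant under `delayMap`: otherwise approximating it by a level set
contradicts the recurrence along the levels labelled by `M_{b,1}`. -/
theorem measure_inter_preimage_delayMap_compl {α : ℕ → ℤ → K} (hα : P.Admissible α)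
    (b : Function.periodicPts v) {δ : (Fin p → ℕ) × ℕ} (hδ : (∀ i, δ.1 i ≤ 1) ∧ δ.2 ≤ 1)
    {A : Set ((Fin p → P.toCFData.X) × (P.toCFData.X × K))} (hA : MeasurableSet A)
    (hinv : P.toCFData.prodMap p α ⁻¹' A = A) :
    P.toCFData.prodMeasure p lam
      (A ∩ P.toCFData.delayMap α δ (if δ.2 = 0 then (b : K) else 0) ⁻¹' Aᶜ) = 0 := by
  set κ : ENNReal := ((4 * per v b : ENNReal)⁻¹) ^ (p + 1) with hκ
  set β : K := if δ.2 = 0 then (b : K) else 0 with hβ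
  set ν := P.toCFData.prodMeasure p lam with hν
  set Θ := P.toCFData.delayMap (p := p) α δ β with hΘdef
  have hS := measurePreserving_prodMap (p := p) lam P.isTotal α
  have hΘ := measurePreserving_delayMap (p := p) lam P.isTotal α δ β
  have hκ0 : κ ≠ 0 := pow_ne_zero _ (ENNReal.inv_ne_zero.2
    (ENNReal.mul_ne_top (by norm_num) (ENNReal.natCast_ne_top _)))
  have hκ1 : κ ≤ 1 := by
    refine pow_le_one' (ENNReal.inv_le_one.2 ?_) _
    have : 1 ≤ 4 * per v b := by have := per_pos v b; omega
    exact_mod_cast this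
  have hinvk : ∀ k, (P.toCFData.prodMap p α)^[k] ⁻¹' A = A := by
    intro k
    induction k with
    | zero => rfl
    | succ k ih => rw [Function.iterate_succ, Set.preimage_comp, ih, hinv]
  have key : ∀ N, ν ((A ∩ P.toCFData.full p K N) ∩
      Θ ⁻¹' (P.toCFData.full p K N \ A)) = 0 := by
    intro N
    set Y := P.toCFData.full p K N with hY
    have hF : MeasurableSet (Y) := (isLevel_full N).measurableSet
    have hle : ∀ ε : ENNReal, 0 < ε →
        κ * ν ((A ∩ Y) ∩ Θ ⁻¹' (Y \ A)) ≤ 4 * ε := by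
      intro ε hε
      obtain ⟨m, t, ht, hlt⟩ := exists_level_approx lam hA N hε
      obtain ⟨n, hn, hl⟩ := P.frequently_label (.inr (b, 1)) (max 8 (max m N))
      have htn : IsLevel n t := ht.mono (by omega)
      have hFn : IsLevel n (Y) := (isLevel_full N).mono (by omega)
      have hA0 : IsLevel n (Y \ (Y \ t)) := hFn.diff (hFn.diff htn)
      have hB0 : IsLevel n (Y \ t) := hFn.diff htn
      set A0 := Y \ (Y \ t) with hA0def
      set B0 := Y \ t with hB0def
      have hmain := P.measure_inter_preimage_delayMap_le lam hα (by omega) hl hδ hA0 hB0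
      set E := symmDiff t A ∩ Y with hE
      have hEm : MeasurableSet E := (ht.measurableSet.symmDiff hA).inter hF
      have h1 : (P.toCFData.prodMap p α)^[2 * P.h n] ⁻¹' A0 ∩ B0 ⊆
          (P.toCFData.prodMap p α)^[2 * P.h n] ⁻¹' E ∪ E := by
        rintro y ⟨h1, h2⟩
        by_cases hyA : y ∈ A
        · refine Or.inr ⟨Or.inr ⟨hyA, h2.2⟩, h2.1⟩
        · left
          have h3 : (P.toCFData.prodMap p α)^[2 * P.h n] y ∉ A := by
            rw [← hinvk (2 * P.h n)] at hyA; exact hyA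
          have h4 : (P.toCFData.prodMap p α)^[2 * P.h n] y ∈ A0 := h1
          have h5 : (P.toCFData.prodMap p α)^[2 * P.h n] y ∈ t := by
            by_contra h; exact h4.2 ⟨h4.1, h⟩
          exact ⟨Or.inl ⟨h5, h3⟩, h4.1⟩
      have h2 : (A ∩ Y) ∩ Θ ⁻¹' (Y \ A) ⊆
          (A0 ∩ Θ ⁻¹' B0) ∪ (E ∪ Θ ⁻¹' E) := by
        rintro y ⟨⟨h1, h2⟩, h3⟩
        obtain ⟨h3, h4⟩ : Θ y ∈ Y ∧ Θ y ∉ A := h3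
        by_cases h5 : y ∈ t
        · by_cases h6 : Θ y ∈ t
          · exact Or.inr (Or.inr ⟨Or.inl ⟨h6, h4⟩, h3⟩)
          · exact Or.inl ⟨⟨h2, fun h => h.2 h5⟩, h3, h6⟩
        · exact Or.inr (Or.inl ⟨Or.inr ⟨h1, h5⟩, h2⟩)
      have h3 : ν ((P.toCFData.prodMap p α)^[2 * P.h n] ⁻¹' E) = ν E :=
        (hS.iterate _).measure_preimage hEm.nullMeasurableSet
      have h4 : ν (Θ ⁻¹' E) = ν E := hΘ.measure_preimage hEm.nullMeasurableSet
      calc κ * ν ((A ∩ Y) ∩ Θ ⁻¹' (Y \ A))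
          ≤ κ * (ν (A0 ∩ Θ ⁻¹' B0) + (ν E + ν (Θ ⁻¹' E))) := by
            gcongr
            refine (measure_mono h2).trans ((measure_union_le _ _).trans ?_)
            gcongr
            exact measure_union_le _ _
        _ = κ * ν (A0 ∩ Θ ⁻¹' B0) + κ * (ν E + ν E) := by rw [h4, mul_add]
        _ ≤ (ν E + ν E) + 1 * (ν E + ν E) := by
            gcongr
            refine hmain.trans ((measure_mono h1).trans ((measure_union_le _ _).trans ?_))
            rw [h3]
        _ = 4 * ν E := by ring
        _ ≤ 4 * ε := by gcongr
    have hzero : κ * ν ((A ∩ Y) ∩ Θ ⁻¹' (Y \ A)) = 0 := by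
      refine le_antisymm (ENNReal.le_of_forall_pos_le_add fun ε hε _ => ?_) zero_le
      have h4 : (0 : ENNReal) < (ε : ENNReal) / 4 :=
        ENNReal.div_pos (by exact_mod_cast hε.ne') (by norm_num)
      refine (hle _ h4).trans ?_
      rw [ENNReal.mul_div_cancel (by norm_num) (by norm_num), zero_add]
    exact (mul_eq_zero.1 hzero).resolve_left hκ0
  refine measure_mono_null ?_ (measure_iUnion_null key)
  rintro y ⟨h1, h2⟩
  obtain ⟨n, hn⟩ := exists_mem_full y
  obtain ⟨m, hm⟩ := exists_mem_full (Θ y)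
  exact Set.mem_iUnion.2 ⟨max n m, ⟨h1, full_mono (le_max_left _ _) hn⟩,
    full_mono (le_max_right _ _) hm, h2⟩

/-- The restriction of the measure to an invariant set is invariant under `delayMap`. -/
theorem restrict_preimage_delayMap {α : ℕ → ℤ → K} (hα : P.Admissible α)
    (b : Function.periodicPts v) {δ : (Fin p → ℕ) × ℕ} (hδ : (∀ i, δ.1 i ≤ 1) ∧ δ.2 ≤ 1)
    {A : Set ((Fin p → P.toCFData.X) × (P.toCFData.X × K))} (hA : MeasurableSet A)
    (hinv : P.toCFData.prodMap p α ⁻¹' A = A)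
    {E : Set ((Fin p → P.toCFData.X) × (P.toCFData.X × K))} (hE : MeasurableSet E) :
    (P.toCFData.prodMeasure p lam).restrict A
      (P.toCFData.delayMap α δ (if δ.2 = 0 then (b : K) else 0) ⁻¹' E) =
    (P.toCFData.prodMeasure p lam).restrict A E := by
  set Θ := P.toCFData.delayMap α δ (if δ.2 = 0 then (b : K) else 0) with hΘdef
  have hΘ := measurePreserving_delayMap (p := p) lam P.isTotal α δ
    (if δ.2 = 0 then (b : K) else 0)
  have h1 := P.measure_inter_preimage_delayMap_compl lam hα b hδ hA hinv
  have h2 := P.measure_inter_preimage_delayMap_compl lam hα b hδ hA.compl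
    (by rw [Set.preimage_compl, hinv])
  rw [compl_compl] at h2
  have hae : (Θ ⁻¹' E ∩ A : Set _) =ᵐ[P.toCFData.prodMeasure p lam] (Θ ⁻¹' (E ∩ A) : Set _) := by
    rw [ae_eq_set]
    refine ⟨measure_mono_null ?_ h1, measure_mono_null ?_ h2⟩
    · rintro y ⟨⟨h3, h4⟩, h5⟩
      exact ⟨h4, fun h => h5 ⟨h3, h⟩⟩
    · rintro y ⟨⟨h3, h4⟩, h5⟩
      exact ⟨fun h => h5 ⟨h3, h⟩, h4⟩
  rw [Measure.restrict_apply (hΘ.measurable hE), Measure.restrict_apply hE, measure_congr hae,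
    hΘ.measure_preimage (hE.inter hA).nullMeasurableSet]

end SpecialChoice

/-! ### Invariance under a dense set of translations -/

/-- A finite measure on a compact group that is invariant under a dense set of translations is
invariant: the integral of a translate of a continuous function depends continuously on the
translation. -/
theorem isAddLeftInvariant_of_dense {K : Type*} [AddCommGroup K] [TopologicalSpace K]
    [IsTopologicalAddGroup K] [CompactSpace K] [PolishSpace K] [MeasurableSpace K] [BorelSpace K]
    (m : Measure K) [IsFiniteMeasure m] {s : Set K} (hs : Dense s)
    (h : ∀ b ∈ s, m.map (b + ·) = m) : m.IsAddLeftInvariant := by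
  let _ := TopologicalSpace.upgradeIsCompletelyMetrizable K
  refine ⟨fun g => ?_⟩
  refine ext_of_forall_integral_eq_of_IsFiniteMeasure fun f => ?_
  have hmap : ∀ b : K, ∫ x, f x ∂(m.map (b + ·)) = ∫ x, f (b + x) ∂m := fun b =>
    integral_map (measurable_const_add b).aemeasurable
      f.continuous.measurable.aestronglyMeasurable
  have hcont : Continuous fun b : K => ∫ x, f (b + x) ∂m := by
    refine continuous_of_dominated (F := fun b x => f (b + x)) (bound := fun _ => ‖f‖) ?_ ?_ ?_ ?_
    · exact fun b => (f.continuous.comp (continuous_const_add b)).measurable.aestronglyMeasurable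
    · exact fun b => ae_of_all _ fun x => f.norm_coe_le_norm _
    · exact integrable_const _
    · exact ae_of_all _ fun x => f.continuous.comp (continuous_add_const x)
  have hconst : (fun b : K => ∫ x, f (b + x) ∂m) = fun _ => ∫ x, f x ∂m :=
    hcont.ext_on hs continuous_const fun b hb => by
      beta_reduce
      rw [← hmap b, h b hb]
  rw [hmap g]
  exact congrFun hconst g

namespace SpecialChoice

open CFData

/-! ### Ergodicity -/

variable {K : Type*} {v : K → K} (P : SpecialChoice v) {p : ℕ}

theorem valid_zero (n : ℕ) : P.toCFData.Valid n ((0 : Fin p → ℤ), (0 : ℤ)) :=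
  ⟨fun _ => zero_mem_F P.h_pos n, zero_mem_F P.h_pos n⟩

/-- The Cartesian power is a factor of the product with the skew product. -/
theorem ergodic_pi [AddCommGroup K] [MeasurableSpace K] {lam : Measure K} [SFinite lam]
    (hlam : lam Set.univ ≠ 0) {α : ℕ → ℤ → K}
    (hE : Ergodic (P.toCFData.prodMap p α) (P.toCFData.prodMeasure p lam)) :
    Ergodic (fun (x : Fin p → P.toCFData.X) i => P.toCFData.T (x i))
      (Measure.pi fun _ : Fin p => P.toCFData.μ) := by
  refine { measurePreserving_pi _ _ fun _ => measurePreserving_T P.isTotal with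
    aeconst_set := fun A hA hinv => ?_ }
  have hfac : (P.toCFData.μ.prod lam) Set.univ ≠ 0 := by
    intro h
    have h1 : (P.toCFData.μ.prod lam) (P.toCFData.Cyl 0 0 ×ˢ Set.univ) = 0 := measure_mono_null
      (Set.subset_univ _) h
    rw [Measure.prod_prod, mu_cyl (zero_mem_F P.h_pos 0), w_zero, one_mul] at h1
    exact hlam h1
  have hprod : P.toCFData.prodMap p α ⁻¹' (A ×ˢ Set.univ) = A ×ˢ Set.univ := by
    ext y
    simp only [Set.mem_preimage, Set.mem_prod, Set.mem_univ, and_true]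
    exact Set.ext_iff.1 hinv y.1
  have hnull : ∀ B : Set (Fin p → P.toCFData.X),
      P.toCFData.prodMeasure p lam (B ×ˢ Set.univ) = 0 →
      Measure.pi (fun _ : Fin p => P.toCFData.μ) B = 0 := by
    intro B hB
    rw [prodMeasure, Measure.prod_prod] at hB
    exact (mul_eq_zero.1 hB).resolve_right hfac
  have := hE.aeconst_set (hA.prod MeasurableSet.univ) hprod
  rw [eventuallyConst_set'] at this ⊢
  refine this.imp (fun h => ?_) fun h => ?_
  · exact ae_eq_empty.2 (hnull A (ae_eq_empty.1 h))
  · refine ae_eq_univ.2 (hnull Aᶜ ?_)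
    have h1 := ae_eq_univ.1 h
    rwa [Set.compl_prod_eq_union, Set.compl_univ, Set.prod_empty, Set.union_empty] at h1

variable [AddCommGroup K] [MeasurableSpace K] [MeasurableAdd₂ K] (lam : Measure K)
  [IsFiniteMeasure lam] [lam.IsAddLeftInvariant]

/-- Above all boxes of one level, the restriction of the measure to an invariant set is the same, up
to a translation of `K`. -/
theorem restrict_box {α : ℕ → ℤ → K} (hα : P.Admissible α) (h0 : (0 : K) ∈ Function.periodicPts v)
    {A : Set ((Fin p → P.toCFData.X) × (P.toCFData.X × K))} (hA : MeasurableSet A)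
    (hinv : P.toCFData.prodMap p α ⁻¹' A = A) (n M : ℕ) :
    ∀ a : (Fin p → ℤ) × ℤ, P.toCFData.Valid n a → (∀ i, a.1 i ≤ M) → a.2 ≤ M →
      ∀ U : Set K, MeasurableSet U →
      (P.toCFData.prodMeasure p lam).restrict A (P.toCFData.Box n a U) =
      (P.toCFData.prodMeasure p lam).restrict A (P.toCFData.Box n ((0 : Fin p → ℤ), (0 : ℤ))
        ((· + (P.toCFData.height α n a.2 - P.toCFData.height α n 0)) ⁻¹' U)) := by
  induction M with
  | zero =>
    intro a ha h1 h2 U _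
    have ha0 : a = ((0 : Fin p → ℤ), (0 : ℤ)) := Prod.ext
      (funext fun i => le_antisymm (h1 i) (mem_F_iff.1 (ha.1 i)).1)
      (le_antisymm h2 (mem_F_iff.1 ha.2).1)
    subst ha0
    simp
  | succ M ih =>
    intro a ha h1 h2 U hU
    -- decrease all positive entries of the address at once
    let d : ℤ → ℕ := fun z => if 0 < z then 1 else 0
    have hd1 : ∀ z, d z ≤ 1 := fun z => by simp only [d]; split_ifs <;> omega
    have hdF : ∀ z, z ∈ P.toCFData.F n → z - d z ∈ P.toCFData.F n := fun z hz => by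
      rw [mem_F_iff] at hz ⊢; simp only [d]; split_ifs <;> push_cast <;> omega
    have hdM : ∀ z : ℤ, z ≤ (M + 1 : ℕ) → z - d z ≤ M := fun z hz => by
      simp only [d]; split_ifs <;> push_cast at hz ⊢ <;> omega
    let δ : (Fin p → ℕ) × ℕ := (fun i => d (a.1 i), d a.2)
    let a' : (Fin p → ℤ) × ℤ := (fun i => a.1 i - d (a.1 i), a.2 - d a.2)
    have hδ : (∀ i, δ.1 i ≤ 1) ∧ δ.2 ≤ 1 := ⟨fun i => hd1 _, hd1 _⟩
    have haa : addDelay a' δ = a := Prod.ext (funext fun i => by simp [addDelay, a', δ])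
      (by simp [addDelay, a', δ])
    have ha' : P.toCFData.Valid n a' := ⟨fun i => hdF _ (ha.1 i), hdF _ ha.2⟩
    have hstep := P.restrict_preimage_delayMap lam hα ⟨0, h0⟩ hδ hA hinv
      (measurableSet_box n a hU)
    rw [ite_self] at hstep
    have hpre := delayMap_preimage_box P.isTotal α hδ 0 ha' (haa.symm ▸ ha) U
    rw [haa] at hpre
    rw [← hstep, hpre, ih a' ha' (fun i => hdM _ (h1 i)) (hdM _ h2) _
      (measurable_add_const _ hU)]
    congr 2
    ext g
    simp only [Set.mem_preimage, delayShift]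
    rw [show a'.2 + (δ.2 : ℤ) = a.2 from congrArg Prod.snd haa]
    rw [show g + (P.toCFData.height α n a'.2 - P.toCFData.height α n 0) +
      (P.toCFData.height α n a.2 - P.toCFData.height α n a'.2 + -0) =
      g + (P.toCFData.height α n a.2 - P.toCFData.height α n 0) by abel]

end SpecialChoice

namespace SpecialChoice

open CFData

variable {K : Type*} [AddCommGroup K] [TopologicalSpace K] [IsTopologicalAddGroup K]
  [CompactSpace K] [PolishSpace K] [MeasurableSpace K] [BorelSpace K] {v : K → K}
  (P : SpecialChoice v) {p : ℕ} (lam : Measure K) [lam.IsAddHaarMeasure]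

/-- Above each box of level `n`, the restriction of the measure to an invariant set is the same
multiple of the Haar measure of `K`. -/
theorem exists_restrict_box_eq {α : ℕ → ℤ → K} (hα : P.Admissible α)
    (h0 : (0 : K) ∈ Function.periodicPts v) (hdense : Dense (Function.periodicPts v))
    {A : Set ((Fin p → P.toCFData.X) × (P.toCFData.X × K))} (hA : MeasurableSet A)
    (hinv : P.toCFData.prodMap p α ⁻¹' A = A) (n : ℕ) :
    ∃ c : ENNReal, ∀ a : (Fin p → ℤ) × ℤ, P.toCFData.Valid n a → ∀ U : Set K, MeasurableSet U →
      (P.toCFData.prodMeasure p lam).restrict A (P.toCFData.Box n a U) = c * lam U := by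
  set ρ := (P.toCFData.prodMeasure p lam).restrict A with hρ
  set o : (Fin p → ℤ) × ℤ := ((0 : Fin p → ℤ), (0 : ℤ)) with ho
  -- the measure on `K` induced by `ρ` above the box with address `0`
  let m : Measure K := (ρ.restrict (P.toCFData.Box n o Set.univ)).map fun y => y.2.2
  have hm : ∀ U, MeasurableSet U → m U = ρ (P.toCFData.Box n o U) := by
    intro U hU
    have hmeas : Measurable fun y : (Fin p → P.toCFData.X) × (P.toCFData.X × K) => y.2.2 :=
      measurable_snd.comp measurable_snd
    simp only [m]
    rw [Measure.map_apply hmeas hU, Measure.restrict_apply (hmeas hU)]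
    congr 1
    ext y
    simp only [Set.mem_inter_iff, Set.mem_preimage, mem_box, Set.mem_univ, and_true]
    tauto
  have hfin : IsFiniteMeasure m := by
    refine ⟨?_⟩
    rw [hm _ MeasurableSet.univ]
    refine (Measure.restrict_apply_le _ _).trans_lt ?_
    rw [prodMeasure_box lam (P.valid_zero n)]
    exact ENNReal.mul_lt_top (ENNReal.pow_lt_top (w_ne_top n).lt_top)
      (ENNReal.mul_lt_top (w_ne_top n).lt_top (measure_lt_top _ _))
  have hleft : m.IsAddLeftInvariant := by
    have hneg : Dense (Neg.neg ⁻¹' Function.periodicPts v) :=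
      hdense.preimage (Homeomorph.neg K).isOpenMap
    refine isAddLeftInvariant_of_dense m hneg fun b hb => ?_
    ext U hU
    have hδ : (∀ i, ((fun _ => 0, 0) : (Fin p → ℕ) × ℕ).1 i ≤ 1) ∧
        ((fun _ => 0, 0) : (Fin p → ℕ) × ℕ).2 ≤ 1 := ⟨fun _ => zero_le_one, zero_le_one⟩
    have hadd : addDelay o (fun _ => 0, 0) = o := by simp [addDelay, ho]; rfl
    have hstep := P.restrict_preimage_delayMap lam hα ⟨-b, hb⟩ hδ hA hinv
      (measurableSet_box n o hU)
    have hpre := delayMap_preimage_box P.isTotal α hδ (-b) (P.valid_zero n)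
      (hadd.symm ▸ P.valid_zero n) U
    rw [← ho, hadd] at hpre
    rw [if_pos rfl, hpre, ← hρ] at hstep
    rw [Measure.map_apply (measurable_const_add b) hU, hm _ (measurable_const_add b hU), hm U hU,
      ← hstep]
    congr 2
    ext g
    simp only [Set.mem_preimage, delayShift, ho]
    rw [show g + (P.toCFData.height α n (0 + ((0 : ℕ) : ℤ)) - P.toCFData.height α n 0 + - -b) =
      b + g by simp [add_comm]]
  refine ⟨m.addHaarScalarFactor lam, fun a ha U hU => ?_⟩
  obtain ⟨M, hM⟩ : ∃ M : ℕ, (∀ i, a.1 i ≤ M) ∧ a.2 ≤ M :=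
    ⟨P.h n, fun i => (mem_F_iff.1 (ha.1 i)).2.le, (mem_F_iff.1 ha.2).2.le⟩
  rw [hρ, P.restrict_box lam hα h0 hA hinv n M a ha hM.1 hM.2 U hU, ← hρ, ← ho,
    ← hm _ (measurable_add_const _ hU)]
  conv_lhs => rw [Measure.isAddLeftInvariant_eq_smul m lam]
  rw [Measure.smul_apply, measure_preimage_add_right]
  rfl

theorem ergodic_prodMap {α : ℕ → ℤ → K} (hα : P.Admissible α)
    (h0 : (0 : K) ∈ Function.periodicPts v) (hdense : Dense (Function.periodicPts v)) :
    Ergodic (P.toCFData.prodMap p α) (P.toCFData.prodMeasure p lam) := by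
  refine { measurePreserving_prodMap lam P.isTotal α with aeconst_set := fun A hA hinv => ?_ }
  set ν := P.toCFData.prodMeasure p lam with hν
  set ρ := ν.restrict A with hρ
  have hlam : lam Set.univ ≠ 0 := (Measure.measure_univ_ne_zero (μ := lam)).2 (NeZero.ne lam)
  -- On the level sets of one level, `ρ` is a multiple of `ν`.
  have hlevel : ∀ n, ∃ c : ENNReal, ∀ E, IsLevel n E → ρ E = c * ν E := by
    intro n
    obtain ⟨c, hc⟩ := P.exists_restrict_box_eq lam hα h0 hdense hA hinv n
    have hw0 : P.toCFData.w n ^ p * P.toCFData.w n ≠ 0 :=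
      mul_ne_zero (pow_ne_zero _ (w_ne_zero n)) (w_ne_zero n)
    have hwt : P.toCFData.w n ^ p * P.toCFData.w n ≠ ⊤ :=
      ENNReal.mul_ne_top (ENNReal.pow_ne_top (w_ne_top n)) (w_ne_top n)
    refine ⟨c * (P.toCFData.w n ^ p * P.toCFData.w n)⁻¹, fun E hE => ?_⟩
    obtain ⟨U, hU, rfl⟩ := hE
    have hdisj : Pairwise (Function.onFun Disjoint fun a : (Fin p → ℤ) × ℤ =>
        P.toCFData.Box n a (U a)) := fun a a' hne =>
      Set.disjoint_left.2 fun y h1 h2 => hne (box_unique h1 h2)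
    rw [measure_iUnion hdisj fun a => measurableSet_box n a (hU a),
      measure_iUnion hdisj fun a => measurableSet_box n a (hU a), ← ENNReal.tsum_mul_left]
    refine tsum_congr fun a => ?_
    by_cases ha : P.toCFData.Valid n a
    · rw [hρ, hc a ha _ (hU a), prodMeasure_box lam ha, ← mul_assoc (_ ^ p), ← mul_assoc,
        mul_assoc c, ENNReal.inv_mul_cancel hw0 hwt, mul_one]
    · have : P.toCFData.Box n a (U a) = ∅ :=
        Set.eq_empty_of_forall_notMem fun y hy => ha (valid_of_mem_box hy)
      simp [this]
  have hfull0 : ν (P.toCFData.full p K 0) ≠ 0 := by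
    have hle : ν (P.toCFData.Box 0 ((0 : Fin p → ℤ), (0 : ℤ)) Set.univ) ≤
        ν (P.toCFData.full p K 0) := measure_mono
        (Set.subset_iUnion (fun a => P.toCFData.Box 0 a Set.univ) _)
    rw [prodMeasure_box lam (P.valid_zero 0), w_zero, one_pow, one_mul, one_mul] at hle
    exact fun h => hlam (le_antisymm (h ▸ hle) zero_le)
  have hfullt : ∀ n, ν (P.toCFData.full p K n) ≠ ⊤ := fun n => (prodMeasure_full_lt_top lam n).ne
  -- The factor does not depend on the level, as it can be computed from `X_0^p × X_0 × K`.
  set c := ρ (P.toCFData.full p K 0) / ν (P.toCFData.full p K 0) with hc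
  have heq : ρ = c • ν := by
    refine ext_of_levelSets
      (fun n => ((Measure.restrict_apply_le _ _).trans_lt (hfullt n).lt_top).ne) fun n E hE => ?_
    obtain ⟨c', hc'⟩ := hlevel n
    rw [hc' E hE, Measure.smul_apply, smul_eq_mul, hc,
      hc' _ ((isLevel_full 0).mono (Nat.zero_le n)),
      ENNReal.mul_div_cancel_right hfull0 (hfullt 0)]
  have hcompl : c * ν Aᶜ = 0 := by
    have : ρ Aᶜ = 0 := by
      rw [hρ, Measure.restrict_apply hA.compl, Set.compl_inter_self, measure_empty]
    rwa [heq] at this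
  rw [eventuallyConst_set']
  rcases mul_eq_zero.1 hcompl with hc0 | hA0
  · left
    have : ρ A = 0 := by rw [heq, hc0, zero_smul]; rfl
    rw [hρ, Measure.restrict_apply hA, Set.inter_self] at this
    exact ae_eq_empty.2 this
  · right
    exact ae_eq_univ.2 hA0

end SpecialChoice

end

theorem proposition4p1 {K : Type*} [AddCommGroup K] [TopologicalSpace K] [IsTopologicalAddGroup K]
    [CompactSpace K] [PolishSpace K] [MeasurableSpace K] [BorelSpace K]
    (lam : Measure K) [lam.IsAddHaarMeasure]
    (v : K ≃ₜ+ K) (hcount : (Function.periodicPts v).Countable)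
    (hdense : Dense (Function.periodicPts v))
    (P : SpecialChoice v) (α : ℕ → ℤ → K) (hα : P.Admissible α) :
    (∀ p : ℕ, 0 < p →
      Ergodic
        (Prod.map (fun (x : Fin p → P.toCFData.X) i => P.toCFData.T (x i)) (P.toCFData.skew α))
        ((Measure.pi fun _ : Fin p => P.toCFData.μ).prod (P.toCFData.μ.prod lam))) ∧
    (∀ p : ℕ, 0 < p →
      Ergodic (fun (x : Fin p → P.toCFData.X) i => P.toCFData.T (x i))
        (Measure.pi fun _ : Fin p => P.toCFData.μ)) := by
  have h0 : (0 : K) ∈ Function.periodicPts v := ⟨1, one_pos, map_zero v⟩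
  have hlam : lam Set.univ ≠ 0 := (Measure.measure_univ_ne_zero (μ := lam)).2 (NeZero.ne lam)
  exact ⟨fun p _ => P.ergodic_prodMap lam hα h0 hdense,
    fun p _ => P.ergodic_pi hlam (P.ergodic_prodMap lam hα h0 hdense)⟩
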